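/- **Setting.** Let $\mathcal G$ be a connected undirected network on a finite set $\mathcal N$ of $N$ agents. For $\kappa\ge 1$ let $\mathcal N_i^{\kappa}$ be the set of agents at graph distance at most $\kappa$ from $i$ (including $i$), $\mathcal N_i=\mathcal N_i^1$, and $M_\kappa=\max_i|\mathcal N_i^\kappa|$. Put $w_{il}=1/|\mathcal N_l|$ if $i\in\mathcal N_l$ and $w_{il}=0$ otherwise. Let $1\le\kappa_r\le\kappa_p$ and $\gamma\in(0,1)$. Agent $i$ has a local state $s_i$ and a local action $a_i$, with discrete transition probabilities $\mathcal P_i(s_i'|s_i,a_i)$, independent over the agents, and discrete initial distribution $\boldsymbol\rho$ of the global state; a reward $r_i(s_{\mathcal N_i^{\kappa_r}},a_{\mathcal N_i^{\kappa_r}})$; a parameter $\theta_i\in\mathbb R^d$; and a local policy $\pi_i(\cdot|s_i,\boldsymbol\theta)$ that depends on $\boldsymbol\theta=(\theta_j)_{j\in\mathcal N}$ only through $(\theta_j)_{j\in\mathcal N_i^{\kappa_p}}$; given the states, agents act independently. Let $$J(\boldsymbol\theta)=\mathbb E\Big[\frac1N\sum_{t\ge0}\sum_{i}\gamma^t r_{i,t}\Big]$$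 be the discounted average reward when all agents act according to $\boldsymbol\theta$. **Algorithm (extended DSCP).** Start from $p_{i,1}=1$ and $\theta_{j,1}=\breve\theta^i_{j,1}=0$. At iteration $t=1,2,\dots$: 1. $p_{i,t+1}=\sum_{l\in\mathcal N_i}w_{il}p_{l,t}$ and $\hat\theta^i_{j,t}=\frac1{p_{i,t+1}}\sum_{l\in\mathcal N_i}w_{il}\breve\theta^l_{j,t}$; write $\hat{\boldsymbol\theta}^i_t=(\hat\theta^i_{j,t})_j$. 2. Draw independent $T_1\sim\mathrm{Geom}(1-\gamma)$, $T_2\sim\mathrm{Geom}(1-\gamma^{1/2})$ on $\{0,1,2,\dots\}$ and a trajectory $(\boldsymbol s_\tau,\boldsymbol a_\tau)_{0\le\tau\le T_1+T_2}$ started from $\boldsymbol\rho$ in which agent $i$ acts by $\pi_i(\cdot|s_i,\hat{\boldsymbol\theta}^i_t)$. With rewards of the $(\kappa_p+\kappa_r)$-hop neighbors, form $$\hat\nabla_i=\frac1{1-\gamma}\Big(\frac1N\sum_{\tau=0}^{T_2}\gamma^{\tau/2}\sum_{j\in\mathcal N_i^{\kappa_p+\kappa_r}}r_{j,T_1+\tau}\Big)\sum_{j\in\mathcal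 N_i^{\kappa_p}}\nabla_{\theta_i}\log\pi_j(a_{j,T_1}|s_{j,T_1},\hat{\boldsymbol\theta}^i_t).$$ 3. $\theta_{i,t+1}=\theta_{i,t}+\eta_t\hat\nabla_i$, and $\breve\theta^i_{j,t+1}=\sum_{l\in\mathcal N_i}w_{il}\breve\theta^l_{j,t}+\mathbf 1_{\{j\in\mathcal N_i\}}\,w_{ij}N(\theta_{j,t+1}-\theta_{j,t})$. **Assumptions.** (a) $|r_i|\le R$. (b) For all $i$, $j\in\mathcal N_i^{\kappa_p}$ and all $(s_i,a_i)$, $\nabla_{\theta_j}\log\pi_i(a_i|s_i,\boldsymbol\theta)$ exists for all $\boldsymbol\theta$ (in particular $\pi_i>0$), is bounded in norm by $B$, and is $L$-Lipschitz in $\boldsymbol\theta\in\mathbb R^{dN}$. (c) The learning rates satisfy $0<\eta_t\le c/t$ for all $t\ge1$. **Corollary.** There is a constant $C>0$, depending only on $\mathcal G,\gamma,R,B,c$, such that, for every realization of the samples, all $i,j\in\mathcal N$ and all $t\ge1$, $$\|\hat\theta^i_{j,t}-\theta_{j,t}\|\le C\,\frac{M_{\kappa_p}M_{\kappa_p+\kappa_r}\log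 t}{t}.$$ Moreover $J$ is differentiable, and there is a positive function $J_{\sup}(m,m')$, increasing in both arguments and depending only on $\mathcal G,\gamma,R,B,c,L$, such that for all $T\ge2$ $$\frac{\mathbb E\big[\sum_{t=1}^{T-1}\eta_t\|\nabla J(\boldsymbol\theta_t)\|^2\big]}{\sum_{t=1}^{T-1}\eta_t}\le\frac{J_{\sup}(M_{\kappa_p},M_{\kappa_p+\kappa_r})}{\sum_{t=1}^{T-1}\eta_t},$$ where the expectation is finite. If in addition $\sum_{t\ge1}\eta_t=\infty$, then the left-hand side tends to $0$ as $T\to\infty$. -/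

import Mathlib

universe u v w

namespace DSCP

open scoped ENNReal BigOperators

noncomputable section

/-! ### Discrete probability -/

/-- For finitely many factors, a sum over a product of types of products factorizes. -/
theorem tsum_pi_prod {ι : Type w} [Fintype ι] :
    ∀ (α : ι → Type u) (g : ∀ i, α i → ℝ≥0∞),
      ∑' f : (∀ i, α i), ∏ i, g i (f i) = ∏ i, ∑' a, g i a := by
  classical
  refine Fintype.induction_empty_option
    (P := fun (ι : Type w) [Fintype ι] => ∀ (α : ι → Type u) (g : ∀ i, α i → ℝ≥0∞),
      ∑' f : (∀ i, α i), ∏ i, g i (f i) = ∏ i, ∑' a, g i a) ?_ ?_ ?_ ι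
  · intro ι κ _ e ih α g
    let _ : Fintype ι := Fintype.ofEquiv κ e.symm
    have h := ih (fun i => α (e i)) (fun i => g (e i))
    rw [← (Equiv.piCongrLeft α e).tsum_eq]
    rw [← e.prod_comp (fun i => ∑' a, g i a)]
    refine Eq.trans ?_ h
    refine tsum_congr fun f => ?_
    rw [← e.prod_comp]
    simp
  · intro α g
    simp
  · intro ι _ ih α g
    rw [← (Equiv.piOptionEquivProd (β := α)).symm.tsum_eq, ENNReal.tsum_prod']
    simp only [Fintype.prod_option]
    rw [← ih (fun i => α (some i)) (fun i => g (some i)), ← ENNReal.tsum_mul_right]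
    refine tsum_congr fun a => ?_
    rw [← ENNReal.tsum_mul_left]
    rfl

/-- The law of a finite family of independent discrete random variables. -/
def prodPMF {ι : Type w} [Fintype ι] {α : ι → Type u} (p : ∀ i, PMF (α i)) : PMF (∀ i, α i) :=
  ⟨fun f => ∏ i, p i (f i), by
    have h := tsum_pi_prod α (fun i a => p i a)
    simp only [PMF.tsum_coe, Finset.prod_const_one] at h
    exact h ▸ ENNReal.summable.hasSum⟩

/-- The geometric law `Geom (1 - q)` on `{0, 1, 2, …}`: the value `k` has mass `(1 - q) q ^ k`. -/
def geomPMF (q : Set.Ioo (0 : ℝ) 1) : PMF ℕ :=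
  ⟨fun k => ENNReal.ofReal ((1 - (q : ℝ)) * (q : ℝ) ^ k), by
    have h0 : (0 : ℝ) ≤ q := q.2.1.le
    have h1 : (0 : ℝ) ≤ 1 - q := sub_nonneg.2 q.2.2.le
    have h := (hasSum_geometric_of_lt_one h0 q.2.2).mul_left (1 - (q : ℝ))
    rw [mul_inv_cancel₀ (sub_pos.2 q.2.2).ne'] at h
    have h2 := ENNReal.ofReal_tsum_of_nonneg
      (fun k => mul_nonneg h1 (pow_nonneg h0 k)) h.summable
    rw [h.tsum_eq, ENNReal.ofReal_one] at h2
    rw [h2]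
    exact ENNReal.summable.hasSum⟩

/-- The expectation of a real function under a discrete law. -/
def expect {X : Type*} (p : PMF X) (f : X → ℝ) : ℝ := ∑' x, (p x).toReal * f x

/-- The law of the path `(x₀, …, xₙ)` of a Markov chain with initial law `init`, whose transition
from time `k` to time `k + 1` is `step k`. -/
def chainPath {X : Type*} (init : PMF X) (step : ℕ → X → PMF X) : (n : ℕ) → PMF (Fin (n + 1) → X)
  | 0 => init.map fun x _ => x
  | n + 1 => (chainPath init step n).bind fun x =>
      (step n (x (Fin.last n))).map fun y => Fin.snoc (α := fun _ => X) x y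

/-! ### The network -/

section Network

variable {V : Type w} [Fintype V] (G : SimpleGraph V)

open scoped Classical in
/-- The `κ`-hop neighbourhood of agent `i`: the agents at graph distance at most `κ` from `i`,
including `i`. The direct neighbourhood `𝒩ᵢ` (every agent receives its own information) is
`hop G 1 i`. -/
def hop (κ : ℕ) (i : V) : Finset V := Finset.univ.filter fun j => G.edist i j ≤ κ

/-- `M_κ`, the largest size of a `κ`-hop neighbourhood. -/
def maxHop (κ : ℕ) : ℕ := Finset.univ.sup fun i => (hop G κ i).card

open scoped Classical in
/-- The weight `w_{il}`. -/
def weight (i l : V) : ℝ := if i ∈ hop G 1 l then 1 / ((hop G 1 l).card : ℝ) else 0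

end Network

/-! ### Policy parameters -/

/-- Joint policy parameters `θ = (θ_i)_i`, with `θ_i ∈ ℝᵈ`, with the Euclidean norm of `ℝ^{dN}`. -/
abbrev Params (V : Type w) [Fintype V] (d : ℕ) : Type w :=
  PiLp 2 fun _ : V => EuclideanSpace ℝ (Fin d)

section Blocks

variable {V : Type w} [Fintype V] {d : ℕ}

open scoped Classical in
/-- `θ` with its block `θ_i` replaced by `x`. -/
def setBlock (θ : Params V d) (i : V) (x : EuclideanSpace ℝ (Fin d)) : Params V d :=
  WithLp.toLp 2 (Function.update (WithLp.ofLp θ) i x)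

/-- The partial gradient `∇_{θ_i} f (θ)`. -/
def blockGrad (f : Params V d → ℝ) (θ : Params V d) (i : V) : EuclideanSpace ℝ (Fin d) :=
  gradient (fun x => f (setBlock θ i x)) (θ i)

end Blocks

/-! ### The multi-agent model -/

/-- A networked multi-agent model with (discrete) local transition probabilities
`𝒫_i(s_i' | s_i, a_i)`, rewards depending on the `κr`-hop neighbourhoods, and local policies
`π_i(· | s_i, θ)` that depend on `θ` through the parameters of the `κp`-hop neighbours of `i`. -/
structure Model {V : Type w} [Fintype V] (G : SimpleGraph V) (d κp κr : ℕ) where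
  State : V → Type u
  Action : V → Type v
  trans : ∀ i, State i → Action i → PMF (State i)
  reward : V → (∀ j, State j) → (∀ j, Action j) → ℝ
  reward_local : ∀ i s s' a a', (∀ j ∈ hop G κr i, s j = s' j ∧ a j = a' j) →
    reward i s a = reward i s' a'
  init : PMF (∀ j, State j)
  policy : ∀ i, State i → Params V d → PMF (Action i)
  policy_local : ∀ i s (θ θ' : Params V d), (∀ j ∈ hop G κp i, θ j = θ' j) →
    policy i s θ = policy i s θ'

/-- The variables of the algorithm at one iteration: the push-sum weights `p_i`, the policy
parameters `θ_i`, and the intermediate variables `aux i j` (agent `i`'s one about agent `j`). -/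
structure Iterate (V : Type w) [Fintype V] (d : ℕ) where
  p : V → ℝ
  θ : Params V d
  aux : V → Params V d

namespace Iterate

variable {V : Type w} [Fintype V] (G : SimpleGraph V) {d : ℕ}

/-- All weights are `1` and all parameters are `0` at the first iteration. -/
def start : Iterate V d := ⟨fun _ => 1, 0, fun _ => 0⟩

/-- The push-sum weights of the next iteration. -/
def nextP (x : Iterate V d) (i : V) : ℝ := ∑ l ∈ hop G 1 i, weight G i l * x.p l

/-- `x.est G i j` is the estimate of `θ_j` kept by agent `i`. -/
def est (x : Iterate V d) (i : V) : Params V d :=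
  WithLp.toLp 2 fun j => (1 / x.nextP G i) • ∑ l ∈ hop G 1 i, weight G i l • x.aux l j

end Iterate

namespace Model

variable {V : Type w} [Fintype V] {G : SimpleGraph V} {d κp κr : ℕ} (M : Model.{u, v, w} G d κp κr)

/-- Global state-action pairs. -/
abbrev Pair : Type (max u v w) := (∀ i, M.State i) × (∀ i, M.Action i)

/-- The joint policy in which agent `i` acts by its local policy at the parameter `Φ i`. -/
def jointPolicy (Φ : V → Params V d) (s : ∀ i, M.State i) : PMF (∀ i, M.Action i) :=
  prodPMF fun i => M.policy i (s i) (Φ i)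

/-- The law of a state drawn from `μ` with an action drawn at it from the joint policy. -/
def withAction (Φ : V → Params V d) (μ : PMF (∀ i, M.State i)) : PMF M.Pair :=
  μ.bind fun s => (M.jointPolicy Φ s).map fun a => (s, a)

/-- The law of the trajectory `(s₀, a₀, …, sₙ, aₙ)` when agent `i` acts at the parameter `Φ i`. -/
def trajectory (Φ : V → Params V d) (n : ℕ) : PMF (Fin (n + 1) → M.Pair) :=
  chainPath (M.withAction Φ M.init)
    (fun _ x => M.withAction Φ (prodPMF fun i => M.trans i (x.1 i) (x.2 i))) n

/-- The discounted average cumulative reward `J(θ)`. -/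
def J (γ : ℝ) (θ : Params V d) : ℝ :=
  ∑' t : ℕ, γ ^ t * expect (M.trajectory (fun _ => θ) t) fun x =>
    (1 / (Fintype.card V : ℝ)) * ∑ i, M.reward i (x (Fin.last t)).1 (x (Fin.last t)).2

/-- `log π_i(a | s, θ)`. -/
def logPolicy (i : V) (s : M.State i) (a : M.Action i) (θ : Params V d) : ℝ :=
  Real.log (M.policy i s θ a).toReal

/-- Rewards are bounded by `R`. -/
def RewardBound (R : ℝ) : Prop := ∀ i s a, |M.reward i s a| ≤ R

/-- The log-policies have partial gradients with respect to the parameters of the `κp`-hop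
neighbours, of norm at most `B`. -/
def ScoreBound (B : ℝ) : Prop :=
  ∀ i s a θ, M.policy i s θ a ≠ 0 ∧ ∀ j ∈ hop G κp i,
    DifferentiableAt ℝ (fun x => M.logPolicy i s a (setBlock θ j x)) (θ j) ∧
    ‖blockGrad (M.logPolicy i s a) θ j‖ ≤ B

/-- These partial gradients are `L`-Lipschitz in the joint parameter. -/
def ScoreLipschitz (L : ℝ) : Prop :=
  ∀ i s a θ θ', ∀ j ∈ hop G κp i,
    ‖blockGrad (M.logPolicy i s a) θ j - blockGrad (M.logPolicy i s a) θ' j‖ ≤ L * ‖θ - θ'‖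

/-- What is sampled in one iteration: the horizons `T₁, T₂` and the trajectory of length
`T₁ + T₂`. -/
structure Sample where
  T₁ : ℕ
  T₂ : ℕ
  path : Fin (T₁ + T₂ + 1) → M.Pair

/-- The square root of a number in `(0, 1)`, as a number in `(0, 1)`. -/
def sqrtIoo (γ : Set.Ioo (0 : ℝ) 1) : Set.Ioo (0 : ℝ) 1 :=
  ⟨√(γ : ℝ), Real.sqrt_pos.2 γ.2.1, (Real.sqrt_lt' one_pos).2 (by simpa using γ.2.2)⟩

/-- Geometric two-horizon sampling: independent `T₁ ~ Geom (1 - γ)` and `T₂ ~ Geom (1 - γ^{1/2})`,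
and a trajectory of length `T₁ + T₂` of the executed joint policy. -/
def sampleLaw (γ : Set.Ioo (0 : ℝ) 1) (Φ : V → Params V d) : PMF M.Sample :=
  (geomPMF γ).bind fun T₁ => (geomPMF (sqrtIoo γ)).bind fun T₂ =>
    (M.trajectory Φ (T₁ + T₂)).map fun x => ⟨T₁, T₂, x⟩

variable {M}

/-- The estimate of the neighbours' averaged `Q`-function of agent `i`, from the rewards of its
`(κp + κr)`-hop neighbours. -/
def Sample.qEst (ω : M.Sample) (γ : ℝ) (i : V) : ℝ :=
  (1 / (Fintype.card V : ℝ)) * ∑ τ : Fin (ω.T₂ + 1), γ ^ (((τ : ℕ) : ℝ) / 2) *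
    ∑ j ∈ hop G (κp + κr) i,
      M.reward j (ω.path ⟨ω.T₁ + τ, by omega⟩).1 (ω.path ⟨ω.T₁ + τ, by omega⟩).2

/-- The sum of the scores of the `κp`-hop neighbours of agent `i` at time `T₁`, computed at agent
`i`'s own estimate `θ` of the joint parameter. -/
def Sample.scoreEst (ω : M.Sample) (θ : Params V d) (i : V) : EuclideanSpace ℝ (Fin d) :=
  ∑ j ∈ hop G κp i,
    blockGrad (M.logPolicy j ((ω.path ⟨ω.T₁, by omega⟩).1 j) ((ω.path ⟨ω.T₁, by omega⟩).2 j)) θ i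

/-- The estimate of agent `i`'s coupled policy gradient. -/
def Sample.gradEst (ω : M.Sample) (γ : ℝ) (θ : Params V d) (i : V) : EuclideanSpace ℝ (Fin d) :=
  (1 / (1 - γ) * ω.qEst γ i) • ω.scoreEst θ i

variable (M)

/-- The policy parameters after one gradient step with learning rate `η`. -/
def nextθ (γ η : ℝ) (x : Iterate V d) (ω : M.Sample) : Params V d :=
  WithLp.toLp 2 fun i => x.θ i + η • ω.gradEst γ (x.est G i) i

open scoped Classical in
/-- One iteration of the algorithm with learning rate `η` and sample `ω`. -/
def next (γ η : ℝ) (x : Iterate V d) (ω : M.Sample) : Iterate V d where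
  p := x.nextP G
  θ := M.nextθ γ η x ω
  aux := fun i => WithLp.toLp 2 fun j =>
    (∑ l ∈ hop G 1 i, weight G i l • x.aux l j) +
      if j ∈ hop G 1 i then
        (weight G i j * (Fintype.card V : ℝ)) • (M.nextθ γ η x ω j - x.θ j)
      else 0

/-- The variables at iteration `t = k + 1`, for given samples `ω 0, ω 1, …` drawn at the iterations
`1, 2, …`. -/
def run (γ : ℝ) (η : ℕ → ℝ) (ω : ℕ → M.Sample) : ℕ → Iterate V d
  | 0 => Iterate.start
  | k + 1 => M.next γ (η (k + 1)) (run γ η ω k) (ω k)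

/-- The joint law of the variables at the iterations `t = 1, …, n + 1` (`x k` belongs to
`t = k + 1`): at each iteration the sample is drawn by executing the local policies at the current
estimates. -/
def runLaw (γ : Set.Ioo (0 : ℝ) 1) (η : ℕ → ℝ) (n : ℕ) : PMF (Fin (n + 1) → Iterate V d) :=
  chainPath (PMF.pure Iterate.start)
    (fun k x => (M.sampleLaw γ (x.est G)).map fun ω => M.next γ (η (k + 1)) x ω) n

/-- `∑_{t=1}^{n+1} η_t ‖∇J(θ_t)‖²` along a run. -/
def gradSum (γ : ℝ) (η : ℕ → ℝ) (n : ℕ) (x : Fin (n + 1) → Iterate V d) : ℝ :=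
  ∑ k : Fin (n + 1), η (k + 1) * ‖gradient (M.J γ) (x k).θ‖ ^ 2

/-- `E[∑_{t=1}^{T-1} η_t ‖∇J(θ_t)‖²] / ∑_{t=1}^{T-1} η_t` for `T = n + 2`. -/
def avgGrad (γ : Set.Ioo (0 : ℝ) 1) (η : ℕ → ℝ) (n : ℕ) : ℝ :=
  expect (M.runLaw γ η n) (M.gradSum γ η n) / ∑ k : Fin (n + 1), η (k + 1)

end Model

end

end DSCP

/-!
The proof has three ingredients.

*Consensus.* The weights form a column-stochastic matrix `W`, some power of which is entrywise
positive because the network is connected and has self-loops. Hence the rows of `Wᵐ` become constant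
at a geometric rate (`exists_weightMatrix_pow_sub_le`), while the push-sum weights `Wᵐ 1` stay above
`1 / N` because the vector of neighbourhood sizes is fixed by `W`. Each increment of a parameter,
which is `O(1 / t)`, is therefore known to all agents up to an error that decays geometrically with
its age, and the estimates are off by `O(1 / t)` (`Model.exists_norm_est_sub_le`).

*The policy gradient.* Between two parameters the density ratio of a trajectory of length `n` is the
exponential of a sum of differences of log-policies. Elementary inequalities for the exponential
turn this into bounds on expectations that hold for all pairs of parameters, with errors polynomial
in `n`: a Lipschitz bound and a first-order expansion with quadratic remainder
(`Model.abs_expect_trajectory_sub_le`, `Model.abs_expect_trajectory_sub_sub_le`). Summed against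
`γᵗ`, the expansion shows that `J` is differentiable, identifies its gradient, and gives the ascent
inequality (`Model.hasGradientAt_J`, `Model.J_add_le`), without any differentiation under a sum.

*The gradient estimates.* The two geometric horizons reproduce the double discounted sum over the
times of the score and of the reward (`expect_two_horizons`). Restricting the rewards to the
`(κp + κr)`-hop neighbours costs nothing: the other rewards have a law that does not depend on the
block `θ_i`, so the derivative of their expectation in this block is zero
(`Model.expect_reward_mul_pathScore_eq_zero`). If all agents acted at the same parameter, the
estimates would thus be unbiased; by the Lipschitz bound their bias is at most proportional to the
consensus error (`Model.abs_expect_gradEst_sub_inner_le`).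

Each iteration then increases `J` in the mean by `η_t ‖∇J‖²` up to an error `O(1 / t²)`, and `J` is
bounded, so the expected sum of `η_t ‖∇J‖²` is bounded (`Model.expect_gradSum_le`).
-/

namespace DSCP

open scoped ENNReal BigOperators

noncomputable section

/-! ### Expectations of bounded functions under a discrete law -/

section Expect

variable {X Y : Type*}

theorem hasSum_toReal (p : PMF X) : HasSum (fun x => (p x).toReal) 1 := by
  have h : ∑' x, p x ≠ ∞ := by rw [p.tsum_coe]; exact ENNReal.one_ne_top
  have h1 := (ENNReal.summable_toReal h).hasSum
  rwa [← ENNReal.tsum_toReal_eq (fun x => p.apply_ne_top x), p.tsum_coe, ENNReal.toReal_one] at h1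

theorem summable_expect (p : PMF X) {f : X → ℝ} {K : ℝ} (hf : ∀ x, |f x| ≤ K) :
    Summable fun x => (p x).toReal * f x := by
  refine Summable.of_norm_bounded ((hasSum_toReal p).summable.mul_right K) fun x => ?_
  rw [norm_mul, Real.norm_of_nonneg ENNReal.toReal_nonneg]
  exact mul_le_mul_of_nonneg_left (hf x) ENNReal.toReal_nonneg

theorem expect_const (p : PMF X) (K : ℝ) : expect p (fun _ => K) = K := by
  simp [expect, tsum_mul_right, (hasSum_toReal p).tsum_eq]

theorem expect_add (p : PMF X) {f g : X → ℝ} {K K' : ℝ} (hf : ∀ x, |f x| ≤ K)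
    (hg : ∀ x, |g x| ≤ K') : expect p (fun x => f x + g x) = expect p f + expect p g := by
  simp only [expect, mul_add]
  exact (summable_expect p hf).tsum_add (summable_expect p hg)

theorem expect_const_mul (p : PMF X) (K : ℝ) (f : X → ℝ) :
    expect p (fun x => K * f x) = K * expect p f := by
  simp only [expect, ← tsum_mul_left]
  exact tsum_congr fun x => by ring

theorem expect_sub (p : PMF X) {f g : X → ℝ} {K K' : ℝ} (hf : ∀ x, |f x| ≤ K)
    (hg : ∀ x, |g x| ≤ K') : expect p (fun x => f x - g x) = expect p f - expect p g := by
  simp only [expect, mul_sub]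
  exact (summable_expect p hf).tsum_sub (summable_expect p hg)

theorem expect_sum {ι : Type*} (s : Finset ι) (p : PMF X) {f : ι → X → ℝ} {K : ι → ℝ}
    (hf : ∀ i x, |f i x| ≤ K i) :
    expect p (fun x => ∑ i ∈ s, f i x) = ∑ i ∈ s, expect p (f i) := by
  simp only [expect, Finset.mul_sum]
  exact Summable.tsum_finsetSum fun i _ => summable_expect p (hf i)

theorem expect_mono (p : PMF X) {f g : X → ℝ} {K K' : ℝ} (hf : ∀ x, |f x| ≤ K)
    (hg : ∀ x, |g x| ≤ K') (h : ∀ x ∈ p.support, f x ≤ g x) : expect p f ≤ expect p g := by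
  refine (summable_expect p hf).tsum_le_tsum (fun x => ?_) (summable_expect p hg)
  by_cases hx : x ∈ p.support
  · exact mul_le_mul_of_nonneg_left (h x hx) ENNReal.toReal_nonneg
  · rw [PMF.mem_support_iff, not_not] at hx
    simp [hx]

theorem abs_expect_le (p : PMF X) {f : X → ℝ} {K : ℝ} (hf : ∀ x, |f x| ≤ K) :
    |expect p f| ≤ K := by
  rw [abs_le]
  refine ⟨?_, ?_⟩
  · rw [← expect_const p (-K)]
    exact expect_mono p (fun _ => le_rfl) hf fun x _ => (abs_le.1 (hf x)).1
  · conv_rhs => rw [← expect_const p K]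
    exact expect_mono p hf (fun _ => le_rfl) fun x _ => (abs_le.1 (hf x)).2

theorem expect_pure (x : X) (f : X → ℝ) : expect (PMF.pure x) f = f x := by
  classical
  rw [expect, tsum_eq_single x]
  · simp
  · intro y hy
    simp [PMF.pure_apply, hy]

theorem expect_bind (p : PMF X) (q : X → PMF Y) {f : Y → ℝ} {K : ℝ} (hf : ∀ y, |f y| ≤ K) :
    expect (p.bind q) f = expect p fun x => expect (q x) f := by
  have hs : Summable fun z : X × Y => (p z.1).toReal * (q z.1 z.2).toReal := by
    have h : ∑' z : X × Y, p z.1 * q z.1 z.2 ≠ ∞ := by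
      rw [ENNReal.tsum_prod']
      simp [ENNReal.tsum_mul_left, PMF.tsum_coe]
    simpa only [ENNReal.toReal_mul] using ENNReal.summable_toReal h
  have hs' : Summable (Function.uncurry fun (x : X) (y : Y) =>
      (p x).toReal * ((q x y).toReal * f y)) := by
    refine Summable.of_norm_bounded (hs.mul_right K) fun z => ?_
    rw [Function.uncurry, ← mul_assoc, norm_mul,
      Real.norm_of_nonneg (mul_nonneg ENNReal.toReal_nonneg ENNReal.toReal_nonneg)]
    exact mul_le_mul_of_nonneg_left (hf _) (mul_nonneg ENNReal.toReal_nonneg ENNReal.toReal_nonneg)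
  simp only [expect, ← tsum_mul_left]
  rw [← hs'.tsum_comm]
  refine tsum_congr fun y => ?_
  rw [PMF.bind_apply, ENNReal.tsum_toReal_eq fun x =>
    ENNReal.mul_ne_top (p.apply_ne_top x) ((q x).apply_ne_top y), ← tsum_mul_right]
  exact tsum_congr fun x => by rw [ENNReal.toReal_mul, mul_assoc]

theorem expect_map (p : PMF X) (g : X → Y) {f : Y → ℝ} {K : ℝ} (hf : ∀ y, |f y| ≤ K) :
    expect (p.map g) f = expect p fun x => f (g x) := by
  rw [← PMF.bind_pure_comp, expect_bind p _ hf]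
  simp only [Function.comp_apply, expect_pure]

/-- Two laws whose density ratio lies in `[exp (-δ), exp δ]` differ by at most `2 δ` in total
variation. The bound is linear in `δ` without a smallness condition, because
`|exp u - 1| ≤ |u| (exp u + 1)`. -/
theorem abs_expect_sub_le_of_exp (p q : PMF X) {l f : X → ℝ} {F δ : ℝ}
    (hl : ∀ x, (q x).toReal = (p x).toReal * Real.exp (l x)) (hδ : ∀ x, |l x| ≤ δ)
    (hf : ∀ x, |f x| ≤ F) : |expect q f - expect p f| ≤ 2 * F * δ := by
  have key : ∀ u : ℝ, |Real.exp u - 1| ≤ |u| * (Real.exp u + 1) := by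
    intro u
    have h1 := Real.add_one_le_exp u
    have h2 := Real.add_one_le_exp (-u)
    have h3 : Real.exp (-u) * Real.exp u = 1 := by rw [← Real.exp_add]; simp
    have h4 := Real.exp_pos u
    have h5 : Real.exp u - 1 ≤ u * Real.exp u := by nlinarith
    rcases le_total 0 u with h | h
    · rw [abs_of_nonneg h, abs_of_nonneg (by linarith)]; nlinarith
    · rw [abs_of_nonpos h, abs_of_nonpos (by linarith [Real.exp_le_one_iff.2 h])]; nlinarith
  have hs : Summable fun x => F * δ * ((q x).toReal + (p x).toReal) :=
    ((hasSum_toReal q).summable.add (hasSum_toReal p).summable).mul_left _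
  rw [expect, expect, ← (summable_expect q hf).tsum_sub (summable_expect p hf)]
  refine (tsum_of_norm_bounded (f := fun x => (q x).toReal * f x - (p x).toReal * f x)
    hs.hasSum fun x => ?_).trans ?_
  · have h0 : (0 : ℝ) ≤ (p x).toReal := ENNReal.toReal_nonneg
    have h : (q x).toReal * f x - (p x).toReal * f x
        = (p x).toReal * (f x * (Real.exp (l x) - 1)) := by rw [hl]; ring
    rw [h, norm_mul, Real.norm_of_nonneg h0, norm_mul, Real.norm_eq_abs, Real.norm_eq_abs]
    calc (p x).toReal * (|f x| * |Real.exp (l x) - 1|)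
        ≤ (p x).toReal * (F * (δ * (Real.exp (l x) + 1))) := by
          have := hf x
          have hF : 0 ≤ F := (abs_nonneg _).trans this
          have := (key (l x)).trans
            (mul_le_mul_of_nonneg_right (hδ x) (by positivity))
          gcongr
      _ = F * δ * ((q x).toReal + (p x).toReal) := by rw [hl]; ring
  · rw [tsum_mul_left, (hasSum_toReal q).summable.tsum_add (hasSum_toReal p).summable,
      (hasSum_toReal q).tsum_eq, (hasSum_toReal p).tsum_eq]
    linarith

/-- The first-order expansion of an expectation in the log-density, with a quadratic remainder
that needs no smallness condition. -/
theorem abs_expect_sub_sub_le_of_exp (p q : PMF X) {l f : X → ℝ} {F δ : ℝ}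
    (hl : ∀ x, (q x).toReal = (p x).toReal * Real.exp (l x)) (hδ : ∀ x, |l x| ≤ δ)
    (hf : ∀ x, |f x| ≤ F) :
    |expect q f - expect p f - expect p (fun x => f x * l x)| ≤ 2 * F * δ ^ 2 := by
  have key : ∀ u : ℝ, |Real.exp u - 1 - u| ≤ u ^ 2 * (Real.exp u + 1) := by
    intro u
    have h1 := Real.add_one_le_exp u
    have h2 := Real.add_one_le_exp (-u)
    have h3 : Real.exp (-u) * Real.exp u = 1 := by rw [← Real.exp_add]; simp
    have h4 := Real.exp_pos u
    have h5 : Real.exp u - 1 ≤ u * Real.exp u := by nlinarith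
    rw [abs_of_nonneg (by linarith)]
    rcases le_total 0 u with h | h
    · nlinarith
    · nlinarith [sq_nonneg u]
  have hfl : ∀ x, |f x * l x| ≤ F * δ := fun x => by
    rw [abs_mul]
    exact mul_le_mul (hf x) (hδ x) (abs_nonneg _) ((abs_nonneg _).trans (hf x))
  have hs : Summable fun x => F * δ ^ 2 * ((q x).toReal + (p x).toReal) :=
    ((hasSum_toReal q).summable.add (hasSum_toReal p).summable).mul_left _
  rw [expect, expect, expect, ← (summable_expect q hf).tsum_sub (summable_expect p hf),
    ← ((summable_expect q hf).sub (summable_expect p hf)).tsum_sub (summable_expect p hfl)]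
  refine (tsum_of_norm_bounded (f := fun x => (q x).toReal * f x - (p x).toReal * f x -
    (p x).toReal * (f x * l x)) hs.hasSum fun x => ?_).trans ?_
  · have h0 : (0 : ℝ) ≤ (p x).toReal := ENNReal.toReal_nonneg
    have h : (q x).toReal * f x - (p x).toReal * f x - (p x).toReal * (f x * l x)
        = (p x).toReal * (f x * (Real.exp (l x) - 1 - l x)) := by rw [hl]; ring
    rw [h, norm_mul, Real.norm_of_nonneg h0, norm_mul, Real.norm_eq_abs, Real.norm_eq_abs]
    calc (p x).toReal * (|f x| * |Real.exp (l x) - 1 - l x|)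
        ≤ (p x).toReal * (F * (δ ^ 2 * (Real.exp (l x) + 1))) := by
          have := hf x
          have hF : 0 ≤ F := (abs_nonneg _).trans this
          have := (key (l x)).trans
            (mul_le_mul_of_nonneg_right (sq_le_sq' (abs_le.1 (hδ x)).1 (abs_le.1 (hδ x)).2)
              (by positivity))
          gcongr
      _ = F * δ ^ 2 * ((q x).toReal + (p x).toReal) := by rw [hl]; ring
  · rw [tsum_mul_left, (hasSum_toReal q).summable.tsum_add (hasSum_toReal p).summable,
      (hasSum_toReal q).tsum_eq, (hasSum_toReal p).tsum_eq]
    linarith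

end Expect

/-! ### Laws of Markov chains and of independent families -/

section Chain

variable {X Y : Type*} (init : PMF X) (step : ℕ → X → PMF X)

theorem chainPath_zero_apply (y : Fin 1 → X) : chainPath init step 0 y = init (y 0) := by
  classical
  rw [chainPath, PMF.map_apply, tsum_eq_single (y 0)]
  · rw [if_pos]
    funext i
    rw [Subsingleton.elim i 0]
  · intro x hx
    rw [if_neg]
    rintro rfl
    exact hx rfl

theorem chainPath_succ_apply (n : ℕ) (y : Fin (n + 2) → X) :
    chainPath init step (n + 1) y = chainPath init step n (Fin.init y) *
      step n (y (Fin.last n).castSucc) (y (Fin.last (n + 1))) := by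
  classical
  rw [chainPath, PMF.bind_apply, tsum_eq_single (Fin.init y)]
  · congr 1
    rw [PMF.map_apply, tsum_eq_single (y (Fin.last (n + 1)))]
    · rw [if_pos (Fin.snoc_init_self y).symm]
      rfl
    · intro b hb
      rw [if_neg]
      intro h
      exact hb (by rw [h, Fin.snoc_last])
  · intro x hx
    rw [PMF.map_apply, mul_eq_zero]
    refine Or.inr (ENNReal.tsum_eq_zero.2 fun b => if_neg fun h => hx ?_)
    rw [h, Fin.init_snoc]

theorem expect_chainPath_succ (n : ℕ) {f : (Fin (n + 2) → X) → ℝ} {K : ℝ} (hf : ∀ y, |f y| ≤ K) :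
    expect (chainPath init step (n + 1)) f = expect (chainPath init step n) fun x =>
      expect (step n (x (Fin.last n))) fun y => f (Fin.snoc (α := fun _ => X) x y) := by
  rw [chainPath, expect_bind _ _ hf]
  simp only [expect_map _ _ hf]

/-- The path up to time `m` of a chain run until time `n ≥ m` has the law of a chain run until
time `m`. -/
theorem expect_chainPath_prefix {m n : ℕ} (h : m ≤ n) {f : (Fin (m + 1) → X) → ℝ} {K : ℝ}
    (hf : ∀ y, |f y| ≤ K) :
    expect (chainPath init step n) (fun x => f fun k => x (Fin.castLE (by omega) k)) =
      expect (chainPath init step m) f := by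
  induction n, h using Nat.le_induction with
  | base => simp
  | succ n hmn ih =>
    rw [expect_chainPath_succ init step n (fun _ => hf _), ← ih]
    congr 1
    funext x
    rw [← expect_const (step n (x (Fin.last n)))
      (f fun k => x (Fin.castLE (by omega) k))]
    congr 1
    funext y
    congr 1
    funext k
    have : (Fin.castLE (by omega) k : Fin (n + 2)) =
      Fin.castSucc (Fin.castLE (by omega) k : Fin (n + 1)) := rfl
    rw [this, Fin.snoc_castSucc]

theorem map_last_chainPath_zero :
    (chainPath init step 0).map (fun x => x (Fin.last 0)) = init := by
  rw [chainPath, PMF.map_comp]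
  exact PMF.map_id _

theorem map_last_chainPath_succ (n : ℕ) :
    (chainPath init step (n + 1)).map (fun x => x (Fin.last (n + 1))) =
      ((chainPath init step n).map fun x => x (Fin.last n)).bind (step n) := by
  rw [chainPath, PMF.map_bind, PMF.bind_map]
  congr 1
  funext x
  rw [PMF.map_comp]
  simp only [Function.comp_def, Fin.snoc_last]
  exact PMF.map_id _

end Chain

section Product

variable {ι : Type w} [Fintype ι] {α : ι → Type u}

theorem prodPMF_apply (p : ∀ i, PMF (α i)) (f : ∀ i, α i) : prodPMF p f = ∏ i, p i (f i) := rfl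

/-- The coordinates in `S` of an independent family are an independent family. -/
theorem map_restrict_prodPMF (p : ∀ i, PMF (α i)) (S : Finset ι) :
    (prodPMF p).map (fun f (i : S) => f i) = prodPMF fun i : S => p i := by
  classical
  ext g
  rw [PMF.map_apply, prodPMF_apply]
  have h1 : ∀ f : ∀ i, α i, (if g = fun i : S => f i then prodPMF p f else 0) =
      ∏ i, (if h : i ∈ S then (if f i = g ⟨i, h⟩ then p i (f i) else 0) else p i (f i)) := by
    intro f
    by_cases hg : g = fun i : S => f i
    · subst hg
      rw [if_pos rfl, prodPMF_apply]
      exact Finset.prod_congr rfl fun i _ => by simp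
    · rw [if_neg hg]
      obtain ⟨i, hi⟩ := Function.ne_iff.1 hg
      refine (Finset.prod_eq_zero (Finset.mem_univ (i : ι)) ?_).symm
      rw [dif_pos i.2, if_neg (fun h => hi h.symm)]
  refine (tsum_congr fun f => Eq.trans (by congr) (h1 f)).trans ?_
  rw [tsum_pi_prod α fun i a => if h : i ∈ S then (if a = g ⟨i, h⟩ then p i a else 0) else p i a]
  rw [← Finset.prod_subset (Finset.subset_univ S), ← Finset.prod_coe_sort S]
  · refine Finset.prod_congr rfl fun i _ => ?_
    rw [tsum_eq_single (g i)]
    · simp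
    · intro b hb
      simp [hb]
  · intro i _ hi
    simp [hi, PMF.tsum_coe]

end Product

/-! ### The mixing weights of the network -/

section Network

variable {V : Type w} [Fintype V] (G : SimpleGraph V)

theorem mem_hop {κ : ℕ} {i j : V} : j ∈ hop G κ i ↔ G.edist i j ≤ κ := by
  simp [hop]

theorem mem_hop_comm {κ : ℕ} {i j : V} : j ∈ hop G κ i ↔ i ∈ hop G κ j := by
  rw [mem_hop, mem_hop, SimpleGraph.edist_comm]

theorem self_mem_hop (κ : ℕ) (i : V) : i ∈ hop G κ i := by
  simp [mem_hop]

theorem mem_hop_one_of_adj {i j : V} (h : G.Adj i j) : j ∈ hop G 1 i := by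
  rw [mem_hop, Nat.cast_one]
  exact (SimpleGraph.edist_eq_one_iff_adj.2 h).le

theorem mem_hop_add {κ κ' : ℕ} {i j k : V} (h : j ∈ hop G κ i) (h' : k ∈ hop G κ' j) :
    k ∈ hop G (κ + κ') i := by
  rw [mem_hop] at *
  push_cast
  exact SimpleGraph.edist_triangle.trans (add_le_add h h')

theorem card_hop_pos (κ : ℕ) (i : V) : 0 < (hop G κ i).card :=
  Finset.card_pos.2 ⟨i, self_mem_hop G κ i⟩

theorem card_hop_le_maxHop (κ : ℕ) (i : V) : (hop G κ i).card ≤ maxHop G κ :=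
  Finset.le_sup (f := fun i => (hop G κ i).card) (Finset.mem_univ i)

theorem one_le_maxHop [Nonempty V] (κ : ℕ) : 1 ≤ maxHop G κ :=
  (card_hop_pos G κ (Classical.arbitrary V)).trans_le (card_hop_le_maxHop G κ _)

theorem weight_nonneg (i l : V) : 0 ≤ weight G i l := by
  rw [weight]; split_ifs <;> positivity

theorem weight_pos_of_mem {i l : V} (h : i ∈ hop G 1 l) : 0 < weight G i l := by
  have := card_hop_pos G 1 l
  rw [weight, if_pos h]; positivity

theorem weight_eq_zero {i l : V} (h : i ∉ hop G 1 l) : weight G i l = 0 := by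
  rw [weight, if_neg h]

/-- The weights are column-stochastic. -/
theorem sum_weight (l : V) : ∑ i, weight G i l = 1 := by
  have h0 : ((hop G 1 l).card : ℝ) ≠ 0 := by exact_mod_cast (card_hop_pos G 1 l).ne'
  have h1 : ∀ i ∈ hop G 1 l, weight G i l = 1 / ((hop G 1 l).card : ℝ) := fun i h => if_pos h
  rw [← Finset.sum_subset (Finset.subset_univ (hop G 1 l)) fun i _ h => weight_eq_zero G h,
    Finset.sum_congr rfl h1]
  simp [h0]

theorem sum_hop_weight_smul {E : Type*} [AddCommGroup E] [Module ℝ E] (i : V) (f : V → E) :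
    ∑ l ∈ hop G 1 i, weight G i l • f l = ∑ l, weight G i l • f l := by
  refine Finset.sum_subset (Finset.subset_univ _) fun l _ h => ?_
  rw [weight_eq_zero G fun h' => h ((mem_hop_comm G).1 h'), zero_smul]

/-- The neighbourhood sizes are a fixed vector of the weights. -/
theorem sum_weight_mul_card (i : V) :
    ∑ l, weight G i l * ((hop G 1 l).card : ℝ) = (hop G 1 i).card := by
  have h := sum_hop_weight_smul G i fun l => ((hop G 1 l).card : ℝ)
  simp only [smul_eq_mul] at h
  rw [← h, Finset.card_eq_sum_ones, Nat.cast_sum]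
  refine Finset.sum_congr rfl fun l hl => ?_
  have h0 : ((hop G 1 l).card : ℝ) ≠ 0 := by exact_mod_cast (card_hop_pos G 1 l).ne'
  rw [weight, if_pos ((mem_hop_comm G).1 hl), one_div_mul_cancel h0, Nat.cast_one]

open scoped Classical

/-- The matrix of the weights `w_{il}`. -/
def weightMatrix : Matrix V V ℝ := Matrix.of (weight G)

theorem weightMatrix_apply (i l : V) : weightMatrix G i l = weight G i l := rfl

theorem weightMatrix_pow_nonneg (m : ℕ) (i j : V) : 0 ≤ (weightMatrix G ^ m) i j := by
  induction m generalizing j with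
  | zero => rw [pow_zero, Matrix.one_apply]; split_ifs <;> norm_num
  | succ m ih =>
    rw [pow_succ, Matrix.mul_apply]
    exact Finset.sum_nonneg fun l _ => mul_nonneg (ih l) (weight_nonneg G l j)

theorem sum_weightMatrix_pow (m : ℕ) (j : V) : ∑ i, (weightMatrix G ^ m) i j = 1 := by
  induction m generalizing j with
  | zero => simp [Matrix.one_apply]
  | succ m ih =>
    simp_rw [pow_succ, Matrix.mul_apply]
    rw [Finset.sum_comm]
    simp_rw [← Finset.sum_mul, ih, one_mul]
    exact sum_weight G j

/-- The neighbourhood sizes are a fixed vector of all powers of the weight matrix. -/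
theorem sum_weightMatrix_pow_mul_card (m : ℕ) (i : V) :
    ∑ j, (weightMatrix G ^ m) i j * ((hop G 1 j).card : ℝ) = (hop G 1 i).card := by
  induction m with
  | zero => simp [Matrix.one_apply]
  | succ m ih =>
    simp_rw [pow_succ, Matrix.mul_apply, Finset.sum_mul]
    rw [Finset.sum_comm]
    simp_rw [mul_assoc, ← Finset.mul_sum, weightMatrix_apply, sum_weight_mul_card]
    exact ih

/-- The push-sum weights stay bounded below: the fixed vector of neighbourhood sizes lies between
`1` and `N`, so `Wᵐ 1 ≥ Wᵐ (size / N) ≥ 1 / N`. -/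
theorem inv_card_le_sum_weightMatrix_pow (m : ℕ) (i : V) :
    1 / (Fintype.card V : ℝ) ≤ ∑ j, (weightMatrix G ^ m) i j := by
  have hN : (0 : ℝ) < Fintype.card V := by exact_mod_cast Fintype.card_pos_iff.2 ⟨i⟩
  rw [div_le_iff₀ hN, Finset.sum_mul]
  have h1 : (1 : ℝ) ≤ (hop G 1 i).card := by exact_mod_cast card_hop_pos G 1 i
  refine h1.trans ((sum_weightMatrix_pow_mul_card G m i).symm.le.trans ?_)
  refine Finset.sum_le_sum fun j _ => mul_le_mul_of_nonneg_left ?_ (weightMatrix_pow_nonneg G m i j)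
  exact_mod_cast Finset.card_le_univ _

theorem weightMatrix_pow_pos_succ {m : ℕ} {i j : V} (h : 0 < (weightMatrix G ^ m) i j) :
    0 < (weightMatrix G ^ (m + 1)) i j := by
  rw [pow_succ, Matrix.mul_apply]
  refine Finset.sum_pos' (fun l _ => mul_nonneg (weightMatrix_pow_nonneg G m i l)
    (weight_nonneg G l j)) ⟨j, Finset.mem_univ j, mul_pos h ?_⟩
  exact weight_pos_of_mem G (self_mem_hop G 1 j)

theorem weightMatrix_pow_length_pos {i j : V} (q : G.Walk i j) :
    0 < (weightMatrix G ^ q.length) i j := by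
  induction q with
  | nil => simp
  | @cons i k j h q ih =>
    rw [SimpleGraph.Walk.length_cons, pow_succ', Matrix.mul_apply]
    refine Finset.sum_pos' (fun l _ => mul_nonneg (weight_nonneg G i l)
      (weightMatrix_pow_nonneg G _ l j)) ⟨k, Finset.mem_univ k, mul_pos ?_ ih⟩
    exact weight_pos_of_mem G (mem_hop_one_of_adj G h.symm)

/-- In a connected network some power of the weight matrix has entries bounded below: walks
connect all pairs, and the self-loops make up for the different lengths. -/
theorem exists_le_weightMatrix_pow (hG : G.Connected) :
    ∃ D : ℕ, 0 < D ∧ ∃ δ : ℝ, 0 < δ ∧ δ < 1 ∧ ∀ i j, δ ≤ (weightMatrix G ^ D) i j := by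
  have := hG.nonempty
  have hw : ∀ z : V × V, ∃ m, 0 < (weightMatrix G ^ m) z.1 z.2 := fun z =>
    let ⟨q⟩ := hG.preconnected z.1 z.2
    ⟨_, weightMatrix_pow_length_pos G q⟩
  choose len hlen using hw
  obtain ⟨D, hD⟩ : ∃ D : ℕ, ∀ z, len z ≤ D :=
    ⟨Finset.univ.sup len, fun z => Finset.le_sup (Finset.mem_univ z)⟩
  have hpos : ∀ z : V × V, 0 < (weightMatrix G ^ (D + 1)) z.1 z.2 := fun z =>
    Nat.le_induction (P := fun m _ => 0 < (weightMatrix G ^ m) z.1 z.2) (hlen z)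
      (fun m _ h => weightMatrix_pow_pos_succ G h) (D + 1) ((hD z).trans (Nat.le_succ D))
  obtain ⟨z, -, hz⟩ := Finset.exists_min_image Finset.univ
    (fun z : V × V => (weightMatrix G ^ (D + 1)) z.1 z.2) Finset.univ_nonempty
  refine ⟨D + 1, Nat.succ_pos D, min ((weightMatrix G ^ (D + 1)) z.1 z.2) (1 / 2),
    lt_min (hpos z) (by norm_num), (min_le_right _ _).trans_lt (by norm_num), fun i j => ?_⟩
  exact (min_le_left _ _).trans (hz (i, j) (Finset.mem_univ _))

/-- The spread of a row vector shrinks by `1 - δ` under a column-stochastic matrix whose entries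
are at least `δ`. -/
theorem spread_vecMul_le {K : Matrix V V ℝ} {δ o : ℝ} (hδ : 0 ≤ δ) (hK : ∀ i j, δ ≤ K i j)
    (hsum : ∀ j, ∑ i, K i j = 1) {r : V → ℝ} (hr : ∀ j j', r j - r j' ≤ o) (j j' : V) :
    ∑ l, r l * K l j - ∑ l, r l * K l j' ≤ (1 - δ) * o := by
  obtain ⟨a, -, ha⟩ := Finset.exists_min_image Finset.univ r ⟨j, Finset.mem_univ j⟩
  have h1 : r a ≤ ∑ l, r l * K l j' := by
    calc r a = ∑ l, r a * K l j' := by rw [← Finset.mul_sum, hsum, mul_one]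
      _ ≤ _ := Finset.sum_le_sum fun l _ =>
        mul_le_mul_of_nonneg_right (ha l (Finset.mem_univ l)) (hδ.trans (hK l j'))
  have h2 : ∑ l, r l * K l j ≤ r a + (1 - δ) * o := by
    have h3 : ∑ l, (r l - r a) * K l j ≤ ∑ l, (o * K l j - if l = a then o * δ else 0) := by
      refine Finset.sum_le_sum fun l _ => ?_
      have ho : 0 ≤ o := by simpa using hr a a
      split_ifs with h
      · subst h
        nlinarith [hK l j]
      · rw [sub_zero]
        exact mul_le_mul_of_nonneg_right (hr l a) (hδ.trans (hK l j))
    simp only [sub_mul, Finset.sum_sub_distrib, ← Finset.mul_sum, hsum, Finset.sum_ite_eq',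
      Finset.mem_univ, if_true, mul_one] at h3
    linarith
  linarith

/-- The rows of the powers of the weight matrix become constant at a geometric rate. -/
theorem exists_weightMatrix_pow_sub_le (hG : G.Connected) :
    ∃ C q : ℝ, 0 < C ∧ 0 < q ∧ q < 1 ∧ ∀ (m : ℕ) (i j j' : V),
      (weightMatrix G ^ m) i j - (weightMatrix G ^ m) i j' ≤ C * q ^ m := by
  obtain ⟨D, hD, δ, hδ, hδ1, hW⟩ := exists_le_weightMatrix_pow G hG
  have hD1 : (1 : ℝ) ≤ D := by exact_mod_cast hD
  have hq : 0 < 1 - δ / D := by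
    rw [sub_pos, div_lt_one (by linarith)]; linarith
  have hq1 : 1 - δ / D < 1 := by
    have : 0 < δ / D := by positivity
    linarith
  -- Bernoulli's inequality makes `1 - δ / D` an admissible rate per step.
  have hb : 1 - δ ≤ (1 - δ / D) ^ D := by
    have := one_add_mul_le_pow (a := -(δ / D)) (by linarith) D
    rw [← sub_eq_add_neg] at this
    refine le_trans (le_of_eq ?_) this
    field_simp
    ring
  set q := 1 - δ / D with hqdef
  refine ⟨(q ^ D)⁻¹, q, by positivity, hq, hq1, fun m => ?_⟩
  induction m using Nat.strong_induction_on with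
  | _ m ih =>
    intro i j j'
    rcases lt_or_ge m D with hm | hm
    · have h1 : (weightMatrix G ^ m) i j ≤ 1 := by
        rw [← sum_weightMatrix_pow G m j]
        exact Finset.single_le_sum (f := fun i => (weightMatrix G ^ m) i j)
          (fun l _ => weightMatrix_pow_nonneg G m l j) (Finset.mem_univ i)
      have h2 := weightMatrix_pow_nonneg G m i j'
      have h3 : 1 ≤ (q ^ D)⁻¹ * q ^ m := by
        rw [inv_mul_eq_div, one_le_div (by positivity)]
        exact pow_le_pow_of_le_one hq.le hq1.le hm.le
      linarith
    · obtain ⟨k, rfl⟩ := Nat.exists_eq_add_of_le' hm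
      have h := spread_vecMul_le hδ.le hW (sum_weightMatrix_pow G D) (ih k (by omega) i) j j'
      rw [pow_add, Matrix.mul_apply, Matrix.mul_apply]
      refine h.trans ?_
      have h' : (q ^ D)⁻¹ * q ^ (k + D) = q ^ D * ((q ^ D)⁻¹ * q ^ k) := by rw [pow_add]; ring
      rw [h']
      exact mul_le_mul_of_nonneg_right hb (by positivity)

/-- An entry of a later power is an average of the row of an earlier power, so it is as close to the
entries of that row as these are to each other. -/
theorem exists_abs_weightMatrix_pow_sub_le (hG : G.Connected) :
    ∃ C q : ℝ, 0 < C ∧ 0 < q ∧ q < 1 ∧ ∀ (m t : ℕ) (i j j' : V), m ≤ t →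
      |(weightMatrix G ^ m) i j - (weightMatrix G ^ t) i j'| ≤ C * q ^ m := by
  obtain ⟨C, q, hC, hq, hq1, h⟩ := exists_weightMatrix_pow_sub_le G hG
  refine ⟨C, q, hC, hq, hq1, fun m t i j j' hmt => ?_⟩
  obtain ⟨k, rfl⟩ := Nat.exists_eq_add_of_le hmt
  have h1 : (weightMatrix G ^ m) i j - (weightMatrix G ^ (m + k)) i j' =
      ∑ l, ((weightMatrix G ^ m) i j - (weightMatrix G ^ m) i l) * (weightMatrix G ^ k) l j' := by
    simp_rw [sub_mul, Finset.sum_sub_distrib, ← Finset.mul_sum]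
    rw [sum_weightMatrix_pow, mul_one, pow_add, Matrix.mul_apply]
  rw [h1]
  refine (Finset.abs_sum_le_sum_abs _ _).trans ?_
  calc _ ≤ ∑ l, C * q ^ m * (weightMatrix G ^ k) l j' := by
        refine Finset.sum_le_sum fun l _ => ?_
        rw [abs_mul, abs_of_nonneg (weightMatrix_pow_nonneg G k l j')]
        refine mul_le_mul_of_nonneg_right ?_ (weightMatrix_pow_nonneg G k l j')
        exact abs_sub_le_iff.2 ⟨h m i j l, h m i l j⟩
    _ = C * q ^ m := by rw [← Finset.mul_sum, sum_weightMatrix_pow, mul_one]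

/-- A geometric moving average of the sequence `1 / s` is of order `1 / t`, because
`t / s ≤ 1 + (t - s)`. -/
theorem sum_pow_mul_inv_le {q : ℝ} (hq : 0 < q) (hq1 : q < 1) (k : ℕ) :
    ∑ s ∈ Finset.range k, q ^ (k - s + 1) * (1 / ((s : ℝ) + 1)) ≤
      (1 / (1 - q) ^ 2) * (1 / ((k : ℝ) + 1)) := by
  have hs : HasSum (fun n : ℕ => ((n : ℝ) + 1) * q ^ n) (1 / (1 - q) ^ 2) := by
    have h := hasSum_choose_mul_geometric_of_norm_lt_one 1
      (r := q) (by rwa [Real.norm_of_nonneg hq.le])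
    simpa using h
  have h1 : ∑ s ∈ Finset.range k, (((k - s : ℕ) : ℝ) + 1) * q ^ (k - s) ≤ 1 / (1 - q) ^ 2 := by
    rw [← Finset.sum_image (s := Finset.range k) (g := fun s => k - s)
      (f := fun n : ℕ => ((n : ℝ) + 1) * q ^ n)]
    · exact sum_le_hasSum _ (fun n _ => by positivity) hs
    · intro a ha b hb hab
      simp only [Finset.coe_range, Set.mem_Iio] at ha hb hab
      omega
  have hk : (0 : ℝ) < (k : ℝ) + 1 := by positivity
  rw [mul_one_div, le_div_iff₀ hk, Finset.sum_mul]
  refine le_trans (Finset.sum_le_sum fun s hs => ?_) h1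
  have hsk : s ≤ k := (Finset.mem_range.1 hs).le
  have h2 : 1 / ((s : ℝ) + 1) * ((k : ℝ) + 1) ≤ ((k - s : ℕ) : ℝ) + 1 := by
    rw [one_div_mul_eq_div, div_le_iff₀ (by positivity), Nat.cast_sub hsk]
    have : (s : ℝ) ≤ k := by exact_mod_cast hsk
    nlinarith [(Nat.cast_nonneg s : (0 : ℝ) ≤ s)]
  have h3 : q ^ (k - s + 1) ≤ q ^ (k - s) := pow_le_pow_of_le_one hq.le hq1.le (Nat.le_succ _)
  rw [mul_assoc, mul_comm]
  exact mul_le_mul h2 h3 (by positivity) (by positivity)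

/-- The push-sum ratio tracks the sum of increments `Δ s = O(1 / s)` injected at agent `j`, with
error `O(1 / t)`: an increment of age `m` is spread over the network up to an error `O(qᵐ)`. -/
theorem exists_push_sum_error_le (hG : G.Connected) :
    ∃ C : ℝ, 0 < C ∧ ∀ (d : ℕ) (Δ : ℕ → EuclideanSpace ℝ (Fin d)) (g : ℝ),
      (∀ s : ℕ, ‖Δ s‖ ≤ g * (1 / ((s : ℝ) + 1))) → ∀ (k : ℕ) (i j : V),
      ‖(1 / ∑ l, (weightMatrix G ^ (k + 1)) i l) • ∑ s ∈ Finset.range k,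
          ((Fintype.card V : ℝ) * (weightMatrix G ^ (k - s + 1)) i j) • Δ s -
        ∑ s ∈ Finset.range k, Δ s‖ ≤ C * g * (1 / ((k : ℝ) + 1)) := by
  obtain ⟨C, q, hC, hq, hq1, h⟩ := exists_abs_weightMatrix_pow_sub_le G hG
  have := hG.nonempty
  have hN : (0 : ℝ) < Fintype.card V := by exact_mod_cast Fintype.card_pos
  have hq2 : 0 < (1 - q) ^ 2 := pow_pos (by linarith) 2
  refine ⟨(Fintype.card V) * (Fintype.card V * C) * (1 / (1 - q) ^ 2), by positivity, ?_⟩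
  intro d Δ g hΔ k i j
  set P := ∑ l, (weightMatrix G ^ (k + 1)) i l with hP
  have hPN : 1 / (Fintype.card V : ℝ) ≤ P := inv_card_le_sum_weightMatrix_pow G (k + 1) i
  have hP0 : 0 < P := lt_of_lt_of_le (by positivity) hPN
  have hg : 0 ≤ g := by
    have h0 := (norm_nonneg _).trans (hΔ 0)
    simpa using h0
  have hcoef : ∀ s ∈ Finset.range k,
      |1 / P * ((Fintype.card V : ℝ) * (weightMatrix G ^ (k - s + 1)) i j) - 1| ≤
        (Fintype.card V) * (Fintype.card V * C) * q ^ (k - s + 1) := by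
    intro s _
    have h1 : 1 / P * ((Fintype.card V : ℝ) * (weightMatrix G ^ (k - s + 1)) i j) - 1 =
        1 / P * ∑ l, ((weightMatrix G ^ (k - s + 1)) i j - (weightMatrix G ^ (k + 1)) i l) := by
      rw [Finset.sum_sub_distrib, ← hP, Finset.sum_const, Finset.card_univ, nsmul_eq_mul]
      field_simp
    rw [h1, abs_mul, abs_of_pos (by positivity)]
    have h2 : 1 / P ≤ Fintype.card V := by
      rw [div_le_iff₀ hP0]
      rwa [div_le_iff₀ hN, mul_comm] at hPN
    have h3 : |∑ l, ((weightMatrix G ^ (k - s + 1)) i j - (weightMatrix G ^ (k + 1)) i l)| ≤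
        Fintype.card V * (C * q ^ (k - s + 1)) := by
      refine (Finset.abs_sum_le_sum_abs _ _).trans ?_
      refine (Finset.sum_le_sum fun l _ => h (k - s + 1) (k + 1) i j l (by omega)).trans ?_
      rw [Finset.sum_const, Finset.card_univ, nsmul_eq_mul]
    calc _ ≤ (Fintype.card V : ℝ) * (Fintype.card V * (C * q ^ (k - s + 1))) :=
          mul_le_mul h2 h3 (abs_nonneg _) hN.le
      _ = _ := by ring
  have h4 : (1 / P) • ∑ s ∈ Finset.range k,
        ((Fintype.card V : ℝ) * (weightMatrix G ^ (k - s + 1)) i j) • Δ s -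
        ∑ s ∈ Finset.range k, Δ s = ∑ s ∈ Finset.range k,
        (1 / P * ((Fintype.card V : ℝ) * (weightMatrix G ^ (k - s + 1)) i j) - 1) • Δ s := by
    simp_rw [Finset.smul_sum, smul_smul, sub_smul, one_smul, Finset.sum_sub_distrib]
  rw [h4]
  refine (norm_sum_le _ _).trans ?_
  calc _ ≤ ∑ s ∈ Finset.range k, (Fintype.card V) * (Fintype.card V * C) * q ^ (k - s + 1) *
          (g * (1 / ((s : ℝ) + 1))) := by
        refine Finset.sum_le_sum fun s hs => ?_
        rw [norm_smul]
        exact mul_le_mul (hcoef s hs) (hΔ s) (norm_nonneg _) (by positivity)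
    _ = (Fintype.card V) * (Fintype.card V * C) * g *
          ∑ s ∈ Finset.range k, q ^ (k - s + 1) * (1 / ((s : ℝ) + 1)) := by
        rw [Finset.mul_sum]
        exact Finset.sum_congr rfl fun s _ => by ring
    _ ≤ (Fintype.card V) * (Fintype.card V * C) * g *
          ((1 / (1 - q) ^ 2) * (1 / ((k : ℝ) + 1))) :=
        mul_le_mul_of_nonneg_left (sum_pow_mul_inv_le hq hq1 k) (by positivity)
    _ = _ := by ring

end Network

/-! ### Size of the gradient estimates, and the consensus error -/

theorem rpow_half_eq_sqrt_pow {γ : ℝ} (hγ : 0 ≤ γ) (n : ℕ) : γ ^ ((n : ℝ) / 2) = √γ ^ n := by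
  rw [Real.sqrt_eq_rpow, ← Real.rpow_natCast, ← Real.rpow_mul hγ]
  congr 1
  ring

theorem sqrt_lt_one_of_mem (γ : Set.Ioo (0 : ℝ) 1) : √(γ : ℝ) < 1 := (Model.sqrtIoo γ).2.2

theorem sqrt_pos_of_mem (γ : Set.Ioo (0 : ℝ) 1) : 0 < √(γ : ℝ) := (Model.sqrtIoo γ).2.1

theorem sum_pow_le_inv_one_sub {q : ℝ} (hq : 0 ≤ q) (hq1 : q < 1) (n : ℕ) :
    ∑ τ : Fin n, q ^ (τ : ℕ) ≤ 1 / (1 - q) := by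
  rw [Fin.sum_univ_eq_sum_range (fun k => q ^ k), one_div]
  exact sum_le_hasSum _ (fun k _ => pow_nonneg hq k) (hasSum_geometric_of_lt_one hq hq1)

/-- The bound on the gradient estimates per unit of neighbourhood sizes. -/
def gradConst (γ R B : ℝ) : ℝ := 1 / (1 - γ) * (1 / (1 - √γ)) * R * B

theorem gradConst_pos (γ : Set.Ioo (0 : ℝ) 1) {R B : ℝ} (hR : 0 < R) (hB : 0 < B) :
    0 < gradConst γ R B := by
  have h1 : 0 < 1 - (γ : ℝ) := sub_pos.2 γ.2.2
  have h2 : 0 < 1 - √(γ : ℝ) := sub_pos.2 (sqrt_lt_one_of_mem γ)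
  rw [gradConst]
  positivity

namespace Model

variable {V : Type w} [Fintype V] {G : SimpleGraph V} {d κp κr : ℕ} {M : Model.{u, v, w} G d κp κr}

theorem RewardBound.nonneg {R : ℝ} (hr : M.RewardBound R) (i : V) (x : M.Pair) : 0 ≤ R :=
  (abs_nonneg _).trans (hr i x.1 x.2)

theorem abs_sum_reward_le {R : ℝ} (hr : M.RewardBound R) (S : Finset V) (x : M.Pair) :
    |∑ j ∈ S, M.reward j x.1 x.2| ≤ S.card * R := by
  refine (Finset.abs_sum_le_sum_abs _ _).trans ((Finset.sum_le_sum fun j _ => hr j _ _).trans ?_)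
  rw [Finset.sum_const, nsmul_eq_mul]

theorem abs_qEst_le (γ : Set.Ioo (0 : ℝ) 1) {R : ℝ} (hr : M.RewardBound R) (ω : M.Sample) (i : V) :
    |ω.qEst γ i| ≤ 1 / (1 - √(γ : ℝ)) * (maxHop G (κp + κr) * R) := by
  have hR := hr.nonneg i (ω.path 0)
  have hN : (1 : ℝ) ≤ Fintype.card V := by exact_mod_cast Fintype.card_pos_iff.2 ⟨i⟩
  have hs : 0 < 1 - √(γ : ℝ) := sub_pos.2 (sqrt_lt_one_of_mem γ)
  rw [Sample.qEst, abs_mul, abs_of_nonneg (by positivity)]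
  refine (mul_le_of_le_one_left (abs_nonneg _) ?_).trans ?_
  · rw [div_le_one (by linarith)]
    exact hN
  · refine (Finset.abs_sum_le_sum_abs _ _).trans ?_
    calc _ ≤ ∑ τ : Fin (ω.T₂ + 1), √(γ : ℝ) ^ (τ : ℕ) * (maxHop G (κp + κr) * R) := by
          refine Finset.sum_le_sum fun τ _ => ?_
          rw [rpow_half_eq_sqrt_pow γ.2.1.le, abs_mul, abs_of_nonneg (by positivity)]
          refine mul_le_mul_of_nonneg_left ((abs_sum_reward_le hr _ _).trans ?_) (by positivity)
          have : ((hop G (κp + κr) i).card : ℝ) ≤ maxHop G (κp + κr) := by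
            exact_mod_cast card_hop_le_maxHop G _ i
          exact mul_le_mul_of_nonneg_right this hR
      _ ≤ _ := by
          rw [← Finset.sum_mul]
          exact mul_le_mul_of_nonneg_right
            (sum_pow_le_inv_one_sub (sqrt_pos_of_mem γ).le (sqrt_lt_one_of_mem γ) _) (by positivity)

theorem norm_scoreEst_le {B : ℝ} (hs : M.ScoreBound B) (ω : M.Sample) (θ : Params V d) (i : V) :
    ‖ω.scoreEst θ i‖ ≤ (hop G κp i).card * B := by
  rw [Sample.scoreEst]
  refine (norm_sum_le _ _).trans ((Finset.sum_le_sum fun j hj =>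
    ((hs j _ _ θ).2 i ((mem_hop_comm G).1 hj)).2).trans ?_)
  rw [Finset.sum_const, nsmul_eq_mul]

theorem norm_gradEst_le (γ : Set.Ioo (0 : ℝ) 1) {R B : ℝ} (hB : 0 ≤ B) (hr : M.RewardBound R)
    (hs : M.ScoreBound B) (ω : M.Sample) (θ : Params V d) (i : V) :
    ‖ω.gradEst γ θ i‖ ≤ gradConst γ R B * (maxHop G κp * maxHop G (κp + κr)) := by
  have hR := hr.nonneg i (ω.path 0)
  have h1 : 0 < 1 - (γ : ℝ) := sub_pos.2 γ.2.2
  have h2 : 0 < 1 - √(γ : ℝ) := sub_pos.2 (sqrt_lt_one_of_mem γ)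
  rw [Sample.gradEst, norm_smul, Real.norm_eq_abs, abs_mul, abs_of_nonneg (by positivity)]
  have h3 : ‖ω.scoreEst θ i‖ ≤ maxHop G κp * B := by
    refine (norm_scoreEst_le hs ω θ i).trans (mul_le_mul_of_nonneg_right ?_ hB)
    exact_mod_cast card_hop_le_maxHop G _ i
  calc _ ≤ 1 / (1 - (γ : ℝ)) * (1 / (1 - √(γ : ℝ)) * (maxHop G (κp + κr) * R)) *
        (maxHop G κp * B) := by
        gcongr
        exact abs_qEst_le γ hr ω i
    _ = _ := by rw [gradConst]; ring

open scoped Classical in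
/-- The push-sum weights are the row sums of the powers of the weight matrix. -/
theorem nextP_run (γ : ℝ) (η : ℕ → ℝ) (ω : ℕ → M.Sample) (k : ℕ) (i : V) :
    (M.run γ η ω k).nextP G i = ∑ l, (weightMatrix G ^ (k + 1)) i l := by
  have h0 : ∀ (x : Iterate V d) (i : V), x.nextP G i = ∑ l, weight G i l * x.p l :=
    fun x i => sum_hop_weight_smul G i x.p
  have hp : ∀ i, (M.run γ η ω k).p i = ∑ l, (weightMatrix G ^ k) i l := by
    induction k with
    | zero => intro i; simp [run, Iterate.start, Matrix.one_apply]
    | succ k ih =>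
      intro i
      change (M.run γ η ω k).nextP G i = _
      rw [h0, pow_succ']
      simp_rw [ih, Matrix.mul_apply, Finset.mul_sum]
      rw [Finset.sum_comm]
      rfl
  rw [h0, pow_succ']
  simp_rw [hp, Matrix.mul_apply, Finset.mul_sum]
  rw [Finset.sum_comm]
  rfl

open scoped Classical in
/-- The intermediate variables about agent `j` are the increments of `θ_j`, scaled by `N`, injected at
`j` and spread by the weights since then. -/
theorem aux_run (γ : ℝ) (η : ℕ → ℝ) (ω : ℕ → M.Sample) (k : ℕ) (i j : V) :
    (M.run γ η ω k).aux i j = ∑ s ∈ Finset.range k,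
      ((Fintype.card V : ℝ) * (weightMatrix G ^ (k - s)) i j) •
        ((M.run γ η ω (s + 1)).θ j - (M.run γ η ω s).θ j) := by
  induction k generalizing i with
  | zero => simp [run, Iterate.start]
  | succ k ih =>
    have h1 : (M.run γ η ω (k + 1)).aux i j =
        ∑ l, weight G i l • (M.run γ η ω k).aux l j + (weight G i j * (Fintype.card V : ℝ)) •
          ((M.run γ η ω (k + 1)).θ j - (M.run γ η ω k).θ j) := by
      change (∑ l ∈ hop G 1 i, weight G i l • (M.run γ η ω k).aux l j) +
        (if j ∈ hop G 1 i then (weight G i j * (Fintype.card V : ℝ)) •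
          ((M.run γ η ω (k + 1)).θ j - (M.run γ η ω k).θ j) else 0) = _
      rw [sum_hop_weight_smul]
      split_ifs with h
      · rfl
      · rw [weight_eq_zero G fun h' => h ((mem_hop_comm G).1 h'), zero_mul, zero_smul]
    rw [h1, Finset.sum_range_succ]
    congr 1
    · simp_rw [ih, Finset.smul_sum, smul_smul]
      rw [Finset.sum_comm]
      refine Finset.sum_congr rfl fun s hs => ?_
      rw [← Finset.sum_smul, Nat.sub_add_comm (Finset.mem_range.1 hs).le, pow_succ',
        Matrix.mul_apply, Finset.mul_sum]
      congr 1
      exact Finset.sum_congr rfl fun l _ => by rw [weightMatrix_apply]; ring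
    · rw [Nat.add_sub_cancel_left, pow_one, weightMatrix_apply, mul_comm]

open scoped Classical in
theorem est_run (γ : ℝ) (η : ℕ → ℝ) (ω : ℕ → M.Sample) (k : ℕ) (i j : V) :
    (M.run γ η ω k).est G i j = (1 / ∑ l, (weightMatrix G ^ (k + 1)) i l) •
      ∑ s ∈ Finset.range k, ((Fintype.card V : ℝ) * (weightMatrix G ^ (k - s + 1)) i j) •
        ((M.run γ η ω (s + 1)).θ j - (M.run γ η ω s).θ j) := by
  change (1 / (M.run γ η ω k).nextP G i) •
    ∑ l ∈ hop G 1 i, weight G i l • (M.run γ η ω k).aux l j = _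
  rw [nextP_run, sum_hop_weight_smul]
  congr 1
  simp_rw [aux_run, Finset.smul_sum, smul_smul]
  rw [Finset.sum_comm]
  refine Finset.sum_congr rfl fun s _ => ?_
  rw [← Finset.sum_smul, pow_succ', Matrix.mul_apply, Finset.mul_sum]
  congr 1
  exact Finset.sum_congr rfl fun l _ => by rw [weightMatrix_apply]; ring

theorem θ_run_eq_sum (γ : ℝ) (η : ℕ → ℝ) (ω : ℕ → M.Sample) (k : ℕ) (j : V) :
    (M.run γ η ω k).θ j = ∑ s ∈ Finset.range k,
      ((M.run γ η ω (s + 1)).θ j - (M.run γ η ω s).θ j) := by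
  rw [Finset.sum_range_sub fun s => (M.run γ η ω s).θ j]
  simp [run, Iterate.start]

theorem norm_smul_gradEst_le (γ : Set.Ioo (0 : ℝ) 1) {R B c : ℝ} (hB : 0 ≤ B)
    (hr : M.RewardBound R) (hs : M.ScoreBound B) {η : ℕ → ℝ}
    (hη : ∀ t : ℕ, 1 ≤ t → 0 < η t ∧ η t ≤ c / t) (ω : M.Sample) (θ : Params V d) (k : ℕ) (i : V) :
    ‖η (k + 1) • ω.gradEst γ θ i‖ ≤
      c * gradConst γ R B * (maxHop G κp * maxHop G (κp + κr)) * (1 / ((k : ℝ) + 1)) := by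
  have h1 := hη (k + 1) (Nat.succ_pos k)
  have h2 := norm_gradEst_le γ hB hr hs ω θ i
  rw [norm_smul, Real.norm_of_nonneg h1.1.le]
  calc _ ≤ c / ((k + 1 : ℕ) : ℝ) * (gradConst γ R B * (maxHop G κp * maxHop G (κp + κr))) :=
        mul_le_mul h1.2 h2 (norm_nonneg _) (h1.1.le.trans h1.2)
    _ = _ := by push_cast; ring

/-- The estimates that the agents keep of the parameters are off by `O(1 / t)`. -/
theorem exists_norm_est_sub_le (hG : G.Connected) (γ : Set.Ioo (0 : ℝ) 1) {R B c : ℝ} (hR : 0 < R)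
    (hB : 0 < B) (hc : 0 < c) :
    ∃ C : ℝ, 0 < C ∧ ∀ (d κp κr : ℕ) (M : Model.{u, v, w} G d κp κr) (η : ℕ → ℝ),
      M.RewardBound R → M.ScoreBound B → (∀ t : ℕ, 1 ≤ t → 0 < η t ∧ η t ≤ c / t) →
      ∀ (ω : ℕ → M.Sample) (k : ℕ) (i j : V),
        ‖(M.run γ η ω k).est G i j - (M.run γ η ω k).θ j‖ ≤
          C * (maxHop G κp * maxHop G (κp + κr)) * (1 / ((k : ℝ) + 1)) := by
  obtain ⟨C, hC, h⟩ := exists_push_sum_error_le G hG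
  refine ⟨C * (c * gradConst γ R B), mul_pos hC (mul_pos hc (gradConst_pos γ hR hB)), ?_⟩
  intro d κp κr M η hr hs hη ω k i j
  rw [est_run, θ_run_eq_sum]
  refine (h d (fun s => (M.run γ η ω (s + 1)).θ j - (M.run γ η ω s).θ j)
    (c * gradConst γ R B * (maxHop G κp * maxHop G (κp + κr))) (fun s => ?_) k i j).trans
    (le_of_eq (by ring))
  have h1 : (M.run γ η ω (s + 1)).θ j - (M.run γ η ω s).θ j =
      η (s + 1) • (ω s).gradEst γ ((M.run γ η ω s).est G j) j := by
    change (M.run γ η ω s).θ j + η (s + 1) • (ω s).gradEst γ ((M.run γ η ω s).est G j) j -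
      (M.run γ η ω s).θ j = _
    abel
  rw [h1]
  exact norm_smul_gradEst_le γ hB.le hr hs hη (ω s) _ s j

/-- At the first iteration all estimates are exact, as the vanishing logarithm demands. -/
theorem est_run_zero (γ : ℝ) (η : ℕ → ℝ) (ω : ℕ → M.Sample) (i j : V) :
    (M.run γ η ω 0).est G i j - (M.run γ η ω 0).θ j = 0 := by
  rw [est_run, θ_run_eq_sum]
  simp

end Model

/-! ### First-order expansion from partial gradients -/

section Blocks

variable {V : Type w} [Fintype V] {d : ℕ}

theorem setBlock_apply_self (θ : Params V d) (i : V) (x : EuclideanSpace ℝ (Fin d)) :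
    setBlock θ i x i = x := by
  simp [setBlock]

theorem setBlock_apply_of_ne (θ : Params V d) {i j : V} (h : j ≠ i)
    (x : EuclideanSpace ℝ (Fin d)) : setBlock θ i x j = θ j := by
  simp [setBlock, h]

theorem setBlock_setBlock (θ : Params V d) (i : V) (x y : EuclideanSpace ℝ (Fin d)) :
    setBlock (setBlock θ i x) i y = setBlock θ i y := by
  simp [setBlock]

theorem setBlock_self (θ : Params V d) (i : V) : setBlock θ i (θ i) = θ := by
  simp [setBlock]

theorem norm_le_norm_of_forall_le {x y : Params V d} (h : ∀ i, ‖x i‖ ≤ ‖y i‖) : ‖x‖ ≤ ‖y‖ := by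
  rw [PiLp.norm_eq_of_L2, PiLp.norm_eq_of_L2]
  exact Real.sqrt_le_sqrt (Finset.sum_le_sum fun i _ => pow_le_pow_left₀ (norm_nonneg _) (h i) 2)

theorem norm_block_le (x : Params V d) (i : V) : ‖x i‖ ≤ ‖x‖ := PiLp.norm_apply_le x i

theorem norm_le_card_mul {x : Params V d} {a : ℝ} (h : ∀ i, ‖x i‖ ≤ a) :
    ‖x‖ ≤ Fintype.card V * a := by
  rcases isEmpty_or_nonempty V with hV | ⟨⟨i₀⟩⟩
  · rw [PiLp.norm_eq_of_L2]
    simp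
  · have ha : 0 ≤ a := (norm_nonneg _).trans (h i₀)
    have hN : (1 : ℝ) ≤ Fintype.card V := by exact_mod_cast Fintype.card_pos_iff.2 ⟨i₀⟩
    rw [PiLp.norm_eq_of_L2]
    refine Real.sqrt_le_iff.2 ⟨by positivity, ?_⟩
    calc ∑ i, ‖x i‖ ^ 2 ≤ ∑ _i : V, a ^ 2 :=
          Finset.sum_le_sum fun i _ => pow_le_pow_left₀ (norm_nonneg _) (h i) 2
      _ = Fintype.card V * a ^ 2 := by rw [Finset.sum_const, Finset.card_univ, nsmul_eq_mul]
      _ ≤ (Fintype.card V * a) ^ 2 := by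
        rw [mul_pow]
        exact mul_le_mul_of_nonneg_right (by nlinarith) (sq_nonneg a)

theorem norm_setBlock_sub (θ : Params V d) (i : V) (x : EuclideanSpace ℝ (Fin d)) :
    ‖setBlock θ i x - θ‖ = ‖x - θ i‖ := by
  classical
  rw [PiLp.norm_eq_of_L2, Finset.sum_eq_single i]
  · rw [PiLp.sub_apply, setBlock_apply_self, Real.sqrt_sq (norm_nonneg _)]
  · intro j _ hj
    rw [PiLp.sub_apply, setBlock_apply_of_ne θ hj, sub_self, norm_zero]
    norm_num
  · simp

/-- The derivative in direction `h` that the partial gradients give. -/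
def blockDeriv (f : Params V d → ℝ) (θ h : Params V d) : ℝ :=
  ∑ j, inner ℝ (blockGrad f θ j) (h j)

theorem blockDeriv_add (f : Params V d → ℝ) (θ h h' : Params V d) :
    blockDeriv f θ (h + h') = blockDeriv f θ h + blockDeriv f θ h' := by
  simp [blockDeriv, inner_add_right, Finset.sum_add_distrib]

theorem blockDeriv_smul (f : Params V d → ℝ) (θ : Params V d) (c : ℝ) (h : Params V d) :
    blockDeriv f θ (c • h) = c * blockDeriv f θ h := by
  simp [blockDeriv, inner_smul_right, Finset.mul_sum]

/-- A function on the joint parameters whose partial gradients exist, are bounded by `B` and are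
`L`-Lipschitz. -/
structure BlockSmooth (f : Params V d → ℝ) (B L : ℝ) : Prop where
  differentiableAt : ∀ θ j, DifferentiableAt ℝ (fun x => f (setBlock θ j x)) (θ j)
  norm_le : ∀ θ j, ‖blockGrad f θ j‖ ≤ B
  lipschitz : ∀ θ θ' j, ‖blockGrad f θ j - blockGrad f θ' j‖ ≤ L * ‖θ - θ'‖

variable {f : Params V d → ℝ} {B L : ℝ}

theorem abs_inner_le (x y : EuclideanSpace ℝ (Fin d)) : |inner ℝ x y| ≤ ‖x‖ * ‖y‖ :=
  abs_real_inner_le_norm x y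

theorem BlockSmooth.abs_blockDeriv_le (hf : BlockSmooth f B L) (θ h : Params V d) :
    |blockDeriv f θ h| ≤ Fintype.card V * B * ‖h‖ := by
  refine (Finset.abs_sum_le_sum_abs _ _).trans ?_
  refine (Finset.sum_le_sum (g := fun _ => B * ‖h‖) fun j _ => (abs_inner_le _ _).trans ?_).trans ?_
  · exact mul_le_mul (hf.norm_le θ j) (norm_block_le h j) (norm_nonneg _)
      ((norm_nonneg _).trans (hf.norm_le θ j))
  · rw [Finset.sum_const, Finset.card_univ, nsmul_eq_mul, mul_assoc]

theorem BlockSmooth.hasFDerivAt_block (hf : BlockSmooth f B L) (θ : Params V d) (j : V)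
    (x : EuclideanSpace ℝ (Fin d)) :
    HasFDerivAt (fun x => f (setBlock θ j x))
      (InnerProductSpace.toDual ℝ _ (blockGrad f (setBlock θ j x) j)) x := by
  have h := (hf.differentiableAt (setBlock θ j x) j).hasGradientAt
  simp only [setBlock_setBlock, setBlock_apply_self] at h
  have h2 : blockGrad f (setBlock θ j x) j = gradient (fun x => f (setBlock θ j x)) x := by
    simp only [blockGrad, setBlock_setBlock, setBlock_apply_self]
  rw [h2]
  exact h.hasFDerivAt

theorem BlockSmooth.abs_setBlock_sub_le (hf : BlockSmooth f B L) (θ : Params V d) (j : V)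
    (y : EuclideanSpace ℝ (Fin d)) : |f (setBlock θ j y) - f θ| ≤ B * ‖y - θ j‖ := by
  have h := (convex_univ (𝕜 := ℝ)).norm_image_sub_le_of_norm_hasFDerivWithin_le
    (f := fun x => f (setBlock θ j x)) (C := B)
    (fun x _ => (hf.hasFDerivAt_block θ j x).hasFDerivWithinAt)
    (fun x _ => by rw [LinearIsometryEquiv.norm_map]; exact hf.norm_le _ j)
    (Set.mem_univ (θ j)) (Set.mem_univ y)
  simpa only [setBlock_self, Real.norm_eq_abs] using h

theorem BlockSmooth.abs_setBlock_sub_sub_le (hf : BlockSmooth f B L) (hL : 0 ≤ L)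
    (θ : Params V d) (j : V) (y : EuclideanSpace ℝ (Fin d)) :
    |f (setBlock θ j y) - f θ - inner ℝ (blockGrad f θ j) (y - θ j)| ≤ L * ‖y - θ j‖ ^ 2 := by
  have h := (convex_closedBall (θ j) ‖y - θ j‖).norm_image_sub_le_of_norm_hasFDerivWithin_le'
    (f := fun x => f (setBlock θ j x)) (C := L * ‖y - θ j‖)
    (φ := InnerProductSpace.toDual ℝ _ (blockGrad f θ j))
    (fun x _ => (hf.hasFDerivAt_block θ j x).hasFDerivWithinAt)
    (fun x hx => by
      rw [← map_sub, LinearIsometryEquiv.norm_map]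
      refine (hf.lipschitz _ θ j).trans (mul_le_mul_of_nonneg_left ?_ hL)
      rw [norm_setBlock_sub]
      exact mem_closedBall_iff_norm.1 hx)
    (Metric.mem_closedBall_self (norm_nonneg _)) (mem_closedBall_iff_norm.2 le_rfl)
  simp only [setBlock_self, Real.norm_eq_abs, InnerProductSpace.toDual_apply_apply] at h
  rwa [pow_two, ← mul_assoc]

open scoped Classical in
/-- `θ` with the blocks in `S` replaced by those of `θ'`. -/
def setBlocks (θ θ' : Params V d) (S : Finset V) : Params V d :=
  WithLp.toLp 2 fun j => if j ∈ S then θ' j else θ j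

theorem norm_setBlocks_sub_le (θ θ' : Params V d) (S : Finset V) :
    ‖setBlocks θ θ' S - θ‖ ≤ ‖θ' - θ‖ := by
  refine norm_le_norm_of_forall_le fun i => ?_
  by_cases h : i ∈ S <;> simp [setBlocks, h]

open scoped Classical in
theorem setBlocks_insert (θ θ' : Params V d) (S : Finset V) (j : V) :
    setBlocks θ θ' (insert j S) = setBlock (setBlocks θ θ' S) j (θ' j) := by
  ext i : 1
  by_cases h : i = j
  · subst h
    rw [setBlock_apply_self]
    simp [setBlocks]
  · rw [setBlock_apply_of_ne _ h]
    simp [setBlocks, h]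

theorem setBlocks_apply_of_notMem (θ θ' : Params V d) {S : Finset V} {j : V} (h : j ∉ S) :
    setBlocks θ θ' S j = θ j := by
  simp [setBlocks, h]

theorem setBlocks_univ (θ θ' : Params V d) : setBlocks θ θ' Finset.univ = θ' := by
  ext i : 1
  simp [setBlocks]

theorem BlockSmooth.abs_sub_le (hf : BlockSmooth f B L) (hB : 0 ≤ B) (θ θ' : Params V d) :
    |f θ' - f θ| ≤ Fintype.card V * B * ‖θ' - θ‖ := by
  classical
  have key : ∀ S : Finset V, |f (setBlocks θ θ' S) - f θ| ≤ S.card * (B * ‖θ' - θ‖) := by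
    intro S
    induction S using Finset.induction_on with
    | empty => simp [setBlocks]
    | insert j S hj ih =>
      have h1 := hf.abs_setBlock_sub_le (setBlocks θ θ' S) j (θ' j)
      rw [← setBlocks_insert, setBlocks_apply_of_notMem θ θ' hj, ← PiLp.sub_apply] at h1
      have h2 := mul_le_mul_of_nonneg_left (norm_block_le (θ' - θ) j) hB
      have h3 := _root_.abs_sub_le (f (setBlocks θ θ' (insert j S))) (f (setBlocks θ θ' S)) (f θ)
      rw [Finset.card_insert_of_notMem hj]
      push_cast
      linarith
  have h := key Finset.univ
  rwa [setBlocks_univ, Finset.card_univ, ← mul_assoc] at h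

/-- Lipschitz partial gradients give a first-order expansion with quadratic remainder; the blocks
are replaced one after the other. -/
theorem BlockSmooth.abs_sub_sub_le (hf : BlockSmooth f B L) (hL : 0 ≤ L) (θ θ' : Params V d) :
    |f θ' - f θ - blockDeriv f θ (θ' - θ)| ≤ Fintype.card V * (2 * L) * ‖θ' - θ‖ ^ 2 := by
  classical
  have key : ∀ S : Finset V, |f (setBlocks θ θ' S) - f θ -
      ∑ j ∈ S, inner ℝ (blockGrad f θ j) ((θ' - θ) j)| ≤ S.card * (2 * L * ‖θ' - θ‖ ^ 2) := by
    intro S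
    induction S using Finset.induction_on with
    | empty => simp [setBlocks]
    | insert j S hj ih =>
      have h1 := hf.abs_setBlock_sub_sub_le hL (setBlocks θ θ' S) j (θ' j)
      rw [← setBlocks_insert, setBlocks_apply_of_notMem θ θ' hj, ← PiLp.sub_apply] at h1
      have hb := norm_block_le (θ' - θ) j
      have h2 : L * ‖(θ' - θ) j‖ ^ 2 ≤ L * ‖θ' - θ‖ ^ 2 :=
        mul_le_mul_of_nonneg_left (pow_le_pow_left₀ (norm_nonneg _) hb 2) hL
      have h3 : |inner ℝ (blockGrad f (setBlocks θ θ' S) j) ((θ' - θ) j) -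
          inner ℝ (blockGrad f θ j) ((θ' - θ) j)| ≤ L * ‖θ' - θ‖ ^ 2 := by
        rw [← inner_sub_left]
        refine (abs_inner_le _ _).trans ?_
        have h4 := (hf.lipschitz (setBlocks θ θ' S) θ j).trans
          (mul_le_mul_of_nonneg_left (norm_setBlocks_sub_le θ θ' S) hL)
        calc _ ≤ (L * ‖θ' - θ‖) * ‖θ' - θ‖ :=
              mul_le_mul h4 hb (norm_nonneg _) (by positivity)
          _ = _ := by ring
      rw [Finset.card_insert_of_notMem hj, Finset.sum_insert hj]
      push_cast
      rw [abs_le] at *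
      constructor <;> linarith [h1.1, h1.2, h3.1, h3.2, ih.1, ih.2]
  have h := key Finset.univ
  rwa [setBlocks_univ, Finset.card_univ, ← mul_assoc, ← mul_assoc, mul_assoc _ (2 : ℝ) L] at h

end Blocks

namespace Model

variable {V : Type w} [Fintype V] {G : SimpleGraph V} {d κp κr : ℕ} {M : Model.{u, v, w} G d κp κr}

theorem logPolicy_setBlock_of_notMem {i j : V} (h : j ∉ hop G κp i) (s : M.State i)
    (a : M.Action i) (θ : Params V d) (x : EuclideanSpace ℝ (Fin d)) :
    M.logPolicy i s a (setBlock θ j x) = M.logPolicy i s a θ := by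
  rw [logPolicy, logPolicy, M.policy_local i s (setBlock θ j x) θ]
  intro k hk
  exact setBlock_apply_of_ne θ (fun hkj : k = j => h (hkj ▸ hk)) x

theorem blockGrad_logPolicy_of_notMem {i j : V} (h : j ∉ hop G κp i) (s : M.State i)
    (a : M.Action i) (θ : Params V d) : blockGrad (M.logPolicy i s a) θ j = 0 := by
  rw [blockGrad]
  simp_rw [logPolicy_setBlock_of_notMem h]
  exact gradient_const _ _

theorem blockSmooth_logPolicy {B L : ℝ} (hB : 0 ≤ B) (hL : 0 ≤ L) (hs : M.ScoreBound B)
    (hl : M.ScoreLipschitz L) (i : V) (s : M.State i) (a : M.Action i) :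
    BlockSmooth (M.logPolicy i s a) B L where
  differentiableAt θ j := by
    by_cases h : j ∈ hop G κp i
    · exact ((hs i s a θ).2 j h).1
    · simp_rw [logPolicy_setBlock_of_notMem h]
      exact differentiableAt_const _
  norm_le θ j := by
    by_cases h : j ∈ hop G κp i
    · exact ((hs i s a θ).2 j h).2
    · rw [blockGrad_logPolicy_of_notMem h, norm_zero]
      exact hB
  lipschitz θ θ' j := by
    by_cases h : j ∈ hop G κp i
    · exact hl i s a θ θ' j h
    · rw [blockGrad_logPolicy_of_notMem h, blockGrad_logPolicy_of_notMem h, sub_self, norm_zero]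
      positivity

end Model

/-! ### Likelihood ratios of trajectories -/

theorem abs_sum_univ_le {ι : Type*} [Fintype ι] {f : ι → ℝ} {a : ℝ} (h : ∀ i, |f i| ≤ a) :
    |∑ i, f i| ≤ Fintype.card ι * a := by
  refine (Finset.abs_sum_le_sum_abs _ _).trans ((Finset.sum_le_sum fun i _ => h i).trans ?_)
  rw [Finset.sum_const, Finset.card_univ, nsmul_eq_mul]

/-- An average is bounded by the bound of its terms. -/
theorem abs_avg_le {ι : Type*} [Fintype ι] {f : ι → ℝ} {a : ℝ} (ha : 0 ≤ a) (h : ∀ i, |f i| ≤ a) :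
    |(1 / (Fintype.card ι : ℝ)) * ∑ i, f i| ≤ a := by
  rw [abs_mul, abs_of_nonneg (by positivity)]
  have h := abs_sum_univ_le h
  rcases isEmpty_or_nonempty ι with hV | hV
  · simpa using ha
  · have hN : (0 : ℝ) < Fintype.card ι := by exact_mod_cast Fintype.card_pos
    rw [one_div, inv_mul_le_iff₀ hN]
    exact h

/-- A function with a globally quadratic remainder around a bounded linear form has that form as
its derivative. -/
theorem hasGradientAt_of_quadratic_remainder {E : Type*} [NormedAddCommGroup E]
    [InnerProductSpace ℝ E] [CompleteSpace E] {F : E → ℝ} {x : E} {D : E → ℝ} {A K : ℝ}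
    (hadd : ∀ h h', D (h + h') = D h + D h') (hsmul : ∀ (c : ℝ) h, D (c • h) = c * D h)
    (hA : ∀ h, |D h| ≤ A * ‖h‖) (hK : ∀ y, |F y - F x - D (y - x)| ≤ K * ‖y - x‖ ^ 2) :
    DifferentiableAt ℝ F x ∧ ∀ h, inner ℝ (gradient F x) h = D h := by
  let D₀ : E →ₗ[ℝ] ℝ := { toFun := D, map_add' := hadd, map_smul' := hsmul }
  let D₁ : E →L[ℝ] ℝ := D₀.mkContinuous A hA
  have hD : HasFDerivAt F D₁ x := by
    have h0 : HasFDerivAt (fun y => F y - F x - D₁ (y - x)) (0 : E →L[ℝ] ℝ) x := by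
      refine Asymptotics.IsBigO.hasFDerivAt (n := 2) ?_ one_lt_two
      refine Asymptotics.IsBigO.of_bound K (Filter.Eventually.of_forall fun y => ?_)
      rw [Real.norm_eq_abs, norm_pow, norm_norm]
      exact hK y
    have h1 : HasFDerivAt (fun y => D₁ (y - x) + F x) D₁ x :=
      (D₁.hasFDerivAt.comp x ((hasFDerivAt_id x).sub_const x)).add_const _
    have h2 := h0.add h1
    rw [zero_add] at h2
    refine h2.congr_of_eventuallyEq (Filter.Eventually.of_forall fun y => ?_)
    simp only [Pi.add_apply]
    ring
  refine ⟨hD.differentiableAt, fun h => ?_⟩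
  rw [gradient, InnerProductSpace.toDual_symm_apply, hD.fderiv]
  rfl

namespace Model

variable {V : Type w} [Fintype V] {G : SimpleGraph V} {d κp κr : ℕ} (M : Model.{u, v, w} G d κp κr)

theorem withAction_apply (Φ : V → Params V d) (μ : PMF (∀ i, M.State i)) (x : M.Pair) :
    M.withAction Φ μ x = μ x.1 * ∏ i, M.policy i (x.1 i) (Φ i) (x.2 i) := by
  classical
  obtain ⟨s, a⟩ := x
  rw [withAction, PMF.bind_apply, tsum_eq_single s]
  · congr 1
    rw [PMF.map_apply, tsum_eq_single a]
    · rw [if_pos rfl]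
      rfl
    · intro b hb
      rw [if_neg]
      intro h
      exact hb (Prod.ext_iff.1 h).2.symm
  · intro s' hs'
    rw [PMF.map_apply, mul_eq_zero]
    refine Or.inr (ENNReal.tsum_eq_zero.2 fun b => if_neg fun h => hs' ?_)
    exact (Prod.ext_iff.1 h).1.symm

/-- The log-likelihood ratio of the actions of one time step under the parameters `Φ` and `Ψ`. -/
def stepLog (Φ Ψ : V → Params V d) (x : M.Pair) : ℝ :=
  ∑ i, (M.logPolicy i (x.1 i) (x.2 i) (Φ i) - M.logPolicy i (x.1 i) (x.2 i) (Ψ i))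

/-- The joint score of one time step at `θ`, in direction `h`. -/
def stepScore (θ h : Params V d) (x : M.Pair) : ℝ :=
  ∑ i, blockDeriv (M.logPolicy i (x.1 i) (x.2 i)) θ h

/-- The score of a trajectory at `θ`, in direction `h`. -/
def pathScore (θ h : Params V d) {n : ℕ} (x : Fin (n + 1) → M.Pair) : ℝ :=
  ∑ k, M.stepScore θ h (x k)

theorem stepScore_add (θ h h' : Params V d) (x : M.Pair) :
    M.stepScore θ (h + h') x = M.stepScore θ h x + M.stepScore θ h' x := by
  simp [stepScore, blockDeriv_add, Finset.sum_add_distrib]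

theorem stepScore_smul (θ : Params V d) (c : ℝ) (h : Params V d) (x : M.Pair) :
    M.stepScore θ (c • h) x = c * M.stepScore θ h x := by
  simp [stepScore, blockDeriv_smul, Finset.mul_sum]

theorem pathScore_add (θ h h' : Params V d) {n : ℕ} (x : Fin (n + 1) → M.Pair) :
    M.pathScore θ (h + h') x = M.pathScore θ h x + M.pathScore θ h' x := by
  simp [pathScore, stepScore_add, Finset.sum_add_distrib]

theorem pathScore_smul (θ : Params V d) (c : ℝ) (h : Params V d) {n : ℕ}
    (x : Fin (n + 1) → M.Pair) : M.pathScore θ (c • h) x = c * M.pathScore θ h x := by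
  simp [pathScore, stepScore_smul, Finset.mul_sum]

variable {M} {B L : ℝ}

theorem abs_stepLog_le (hB : 0 ≤ B) (hL : 0 ≤ L) (hs : M.ScoreBound B) (hl : M.ScoreLipschitz L)
    {Φ Ψ : V → Params V d} {ε : ℝ} (hε : ∀ i, ‖Φ i - Ψ i‖ ≤ ε) (x : M.Pair) :
    |M.stepLog Φ Ψ x| ≤ Fintype.card V * (Fintype.card V * B * ε) :=
  abs_sum_univ_le fun i =>
    ((blockSmooth_logPolicy hB hL hs hl i (x.1 i) (x.2 i)).abs_sub_le hB (Ψ i) (Φ i)).trans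
      (mul_le_mul_of_nonneg_left (hε i) (by positivity))

theorem abs_stepScore_le (hB : 0 ≤ B) (hL : 0 ≤ L) (hs : M.ScoreBound B) (hl : M.ScoreLipschitz L)
    (θ h : Params V d) (x : M.Pair) :
    |M.stepScore θ h x| ≤ Fintype.card V * (Fintype.card V * B * ‖h‖) :=
  abs_sum_univ_le fun i =>
    (blockSmooth_logPolicy hB hL hs hl i (x.1 i) (x.2 i)).abs_blockDeriv_le θ h

theorem abs_stepLog_sub_stepScore_le (hB : 0 ≤ B) (hL : 0 ≤ L) (hs : M.ScoreBound B)
    (hl : M.ScoreLipschitz L) (θ θ' : Params V d) (x : M.Pair) :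
    |M.stepLog (fun _ => θ') (fun _ => θ) x - M.stepScore θ (θ' - θ) x| ≤
      Fintype.card V * (Fintype.card V * (2 * L) * ‖θ' - θ‖ ^ 2) := by
  rw [stepLog, stepScore, ← Finset.sum_sub_distrib]
  exact abs_sum_univ_le fun i =>
    (blockSmooth_logPolicy hB hL hs hl i (x.1 i) (x.2 i)).abs_sub_sub_le hL θ θ'

theorem abs_pathScore_le (hB : 0 ≤ B) (hL : 0 ≤ L) (hs : M.ScoreBound B) (hl : M.ScoreLipschitz L)
    (θ h : Params V d) {n : ℕ} (x : Fin (n + 1) → M.Pair) :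
    |M.pathScore θ h x| ≤ (n + 1) * (Fintype.card V * (Fintype.card V * B * ‖h‖)) := by
  simpa [pathScore] using abs_sum_univ_le fun k => abs_stepScore_le hB hL hs hl θ h (x k)

theorem toReal_withAction_eq (hs : M.ScoreBound B) (Φ Ψ : V → Params V d)
    (μ : PMF (∀ i, M.State i)) (x : M.Pair) :
    (M.withAction Φ μ x).toReal = (M.withAction Ψ μ x).toReal * Real.exp (M.stepLog Φ Ψ x) := by
  have hpos : ∀ i (θ : Params V d), 0 < (M.policy i (x.1 i) θ (x.2 i)).toReal := fun i θ =>
    ENNReal.toReal_pos (hs i (x.1 i) (x.2 i) θ).1 (PMF.apply_ne_top _ _)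
  rw [withAction_apply, withAction_apply, ENNReal.toReal_mul, ENNReal.toReal_mul,
    ENNReal.toReal_prod, ENNReal.toReal_prod, stepLog, Real.exp_sum, mul_assoc,
    ← Finset.prod_mul_distrib]
  congr 1
  refine Finset.prod_congr rfl fun i _ => ?_
  rw [Real.exp_sub, logPolicy, logPolicy, Real.exp_log (hpos i _), Real.exp_log (hpos i _),
    mul_div_cancel₀ _ (hpos i _).ne']

theorem toReal_trajectory_eq (hs : M.ScoreBound B) (Φ Ψ : V → Params V d) (n : ℕ)
    (x : Fin (n + 1) → M.Pair) :
    (M.trajectory Φ n x).toReal =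
      (M.trajectory Ψ n x).toReal * Real.exp (∑ k, M.stepLog Φ Ψ (x k)) := by
  induction n with
  | zero =>
    rw [trajectory, trajectory, chainPath_zero_apply, chainPath_zero_apply,
      toReal_withAction_eq hs Φ Ψ]
    simp
  | succ n ih =>
    have ih' := ih (Fin.init x)
    have hsum : ∑ k, M.stepLog Φ Ψ (x k) =
        ∑ k, M.stepLog Φ Ψ (Fin.init x k) + M.stepLog Φ Ψ (x (Fin.last (n + 1))) :=
      Fin.sum_univ_castSucc _
    rw [trajectory, trajectory] at ih' ⊢
    rw [chainPath_succ_apply, chainPath_succ_apply, ENNReal.toReal_mul, ENNReal.toReal_mul, ih',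
      toReal_withAction_eq hs Φ Ψ, hsum, Real.exp_add]
    ring

/-- Expectations over trajectories are Lipschitz in the parameters that the agents act with. -/
theorem abs_expect_trajectory_sub_le (hB : 0 ≤ B) (hL : 0 ≤ L) (hs : M.ScoreBound B)
    (hl : M.ScoreLipschitz L) {Φ Ψ : V → Params V d} {ε : ℝ} (hε : ∀ i, ‖Φ i - Ψ i‖ ≤ ε) (n : ℕ)
    {f : (Fin (n + 1) → M.Pair) → ℝ} {F : ℝ} (hf : ∀ x, |f x| ≤ F) :
    |expect (M.trajectory Φ n) f - expect (M.trajectory Ψ n) f| ≤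
      2 * F * ((n + 1) * (Fintype.card V * (Fintype.card V * B * ε))) := by
  refine abs_expect_sub_le_of_exp _ _ (toReal_trajectory_eq hs Φ Ψ n) (fun x => ?_) hf
  simpa using abs_sum_univ_le fun k => abs_stepLog_le hB hL hs hl hε (x k)

/-- The constant of the second-order remainder of expectations over trajectories. -/
def remConst (N : ℕ) (B L : ℝ) : ℝ := 2 * (N * (N * B)) ^ 2 + N * (N * (2 * L))

theorem remConst_nonneg (N : ℕ) {B L : ℝ} (hL : 0 ≤ L) : 0 ≤ remConst N B L := by
  rw [remConst]; positivity

/-- The score is the derivative of expectations over trajectories, with a quadratic remainder. -/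
theorem abs_expect_trajectory_sub_sub_le (hB : 0 ≤ B) (hL : 0 ≤ L) (hs : M.ScoreBound B)
    (hl : M.ScoreLipschitz L) (θ θ' : Params V d) (n : ℕ)
    {f : (Fin (n + 1) → M.Pair) → ℝ} {F : ℝ} (hf : ∀ x, |f x| ≤ F) :
    |expect (M.trajectory (fun _ => θ') n) f - expect (M.trajectory (fun _ => θ) n) f -
      expect (M.trajectory (fun _ => θ) n) (fun x => f x * M.pathScore θ (θ' - θ) x)| ≤
      F * remConst (Fintype.card V) B L * ((n : ℝ) + 1) ^ 2 * ‖θ' - θ‖ ^ 2 := by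
  set p := M.trajectory (fun _ => θ) n
  set l : (Fin (n + 1) → M.Pair) → ℝ := fun x => ∑ k, M.stepLog (fun _ => θ') (fun _ => θ) (x k)
  set N : ℝ := ((Fintype.card V : ℕ) : ℝ) with hN
  have hN0 : 0 ≤ N := Nat.cast_nonneg _
  have hlb : ∀ x, |l x| ≤ (n + 1) * (N * (N * B * ‖θ' - θ‖)) := fun x => by
    simpa using abs_sum_univ_le fun k =>
      abs_stepLog_le hB hL hs hl (Φ := fun _ => θ') (Ψ := fun _ => θ) (fun _ => le_rfl) (x k)
  have h1 := abs_expect_sub_sub_le_of_exp p (M.trajectory (fun _ => θ') n)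
    (toReal_trajectory_eq hs (fun _ => θ') (fun _ => θ) n) hlb hf
  obtain ⟨x₀, -⟩ := p.support_nonempty
  have hF : 0 ≤ F := (abs_nonneg _).trans (hf x₀)
  have h2 : |expect p (fun x => f x * l x) - expect p (fun x => f x * M.pathScore θ (θ' - θ) x)| ≤
      F * ((n + 1) * (N * (N * (2 * L) * ‖θ' - θ‖ ^ 2))) := by
    have ha : ∀ x, |f x * l x| ≤ F * ((n + 1) * (N * (N * B * ‖θ' - θ‖))) := fun x => by
      rw [abs_mul]
      exact mul_le_mul (hf x) (hlb x) (abs_nonneg _) hF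
    have hb : ∀ x, |f x * M.pathScore θ (θ' - θ) x| ≤
        F * ((n + 1) * (N * (N * B * ‖θ' - θ‖))) := fun x => by
      rw [abs_mul]
      exact mul_le_mul (hf x) (abs_pathScore_le hB hL hs hl θ _ x) (abs_nonneg _) hF
    rw [← expect_sub p ha hb]
    refine abs_expect_le p fun x => ?_
    rw [← mul_sub, abs_mul]
    refine mul_le_mul (hf x) ?_ (abs_nonneg _) hF
    rw [pathScore, ← Finset.sum_sub_distrib]
    simpa using abs_sum_univ_le fun k => abs_stepLog_sub_stepScore_le hB hL hs hl θ θ' (x k)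
  have h3 : F * ((n + 1) * (N * (N * (2 * L) * ‖θ' - θ‖ ^ 2))) ≤
      F * ((n + 1) ^ 2 * (N * (N * (2 * L) * ‖θ' - θ‖ ^ 2))) := by
    have : (n + 1 : ℝ) ≤ (n + 1) ^ 2 := by nlinarith [(Nat.cast_nonneg n : (0 : ℝ) ≤ n)]
    gcongr
  have h4 : F * remConst (Fintype.card V) B L * ((n : ℝ) + 1) ^ 2 * ‖θ' - θ‖ ^ 2 =
      2 * F * ((n + 1) * (N * (N * B * ‖θ' - θ‖))) ^ 2 +
      F * ((n + 1) ^ 2 * (N * (N * (2 * L) * ‖θ' - θ‖ ^ 2))) := by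
    rw [remConst, ← hN]; ring
  rw [h4]
  rw [abs_le] at *
  constructor <;> linarith [h1.1, h1.2, h2.1, h2.2]

/-! ### The policy gradient -/

/-- The average reward of the agents. -/
def avgReward (M : Model.{u, v, w} G d κp κr) (x : M.Pair) : ℝ :=
  (1 / (Fintype.card V : ℝ)) * ∑ i, M.reward i x.1 x.2

theorem abs_avgReward_le {R : ℝ} (hR : 0 ≤ R) (hr : M.RewardBound R) (x : M.Pair) :
    |M.avgReward x| ≤ R :=
  abs_avg_le hR fun i => hr i x.1 x.2

theorem J_eq (γ : ℝ) (θ : Params V d) : M.J γ θ =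
    ∑' t : ℕ, γ ^ t * expect (M.trajectory (fun _ => θ) t) fun x => M.avgReward (x (Fin.last t)) :=
  rfl

theorem summable_pow_mul_sq (γ : Set.Ioo (0 : ℝ) 1) :
    Summable fun t : ℕ => (γ : ℝ) ^ t * ((t : ℝ) + 1) ^ 2 := by
  have hγ : ‖(γ : ℝ)‖ < 1 := by rw [Real.norm_of_nonneg γ.2.1.le]; exact γ.2.2
  have h := ((summable_pow_mul_geometric_of_norm_lt_one (R := ℝ) 2 hγ).add
    ((summable_pow_mul_geometric_of_norm_lt_one (R := ℝ) 1 hγ).mul_left 2)).add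
    (summable_pow_mul_geometric_of_norm_lt_one (R := ℝ) 0 hγ)
  refine h.congr fun t => ?_
  ring

/-- The constant `∑ γᵗ (t + 1)²`. -/
def sqGeom (γ : ℝ) : ℝ := ∑' t : ℕ, γ ^ t * ((t : ℝ) + 1) ^ 2

theorem sqGeom_nonneg (γ : Set.Ioo (0 : ℝ) 1) : 0 ≤ sqGeom γ :=
  tsum_nonneg fun t => mul_nonneg (pow_nonneg γ.2.1.le t) (sq_nonneg _)

theorem abs_tsum_pow_mul_le (γ : Set.Ioo (0 : ℝ) 1) {a : ℕ → ℝ} {A : ℝ}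
    (ha : ∀ t : ℕ, |a t| ≤ A * ((t : ℝ) + 1) ^ 2) :
    |∑' t : ℕ, (γ : ℝ) ^ t * a t| ≤ A * sqGeom γ := by
  rw [sqGeom, ← tsum_mul_left, ← Real.norm_eq_abs]
  refine tsum_of_norm_bounded ((summable_pow_mul_sq γ).mul_left A).hasSum fun t => ?_
  rw [norm_mul, Real.norm_of_nonneg (pow_nonneg γ.2.1.le t), Real.norm_eq_abs]
  calc _ ≤ (γ : ℝ) ^ t * (A * ((t : ℝ) + 1) ^ 2) :=
        mul_le_mul_of_nonneg_left (ha t) (pow_nonneg γ.2.1.le t)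
    _ = _ := by ring

theorem summable_pow_mul (γ : Set.Ioo (0 : ℝ) 1) {a : ℕ → ℝ} {A : ℝ}
    (ha : ∀ t : ℕ, |a t| ≤ A * ((t : ℝ) + 1) ^ 2) : Summable fun t : ℕ => (γ : ℝ) ^ t * a t := by
  refine Summable.of_norm_bounded ((summable_pow_mul_sq γ).mul_left A) fun t => ?_
  rw [norm_mul, Real.norm_of_nonneg (pow_nonneg γ.2.1.le t), Real.norm_eq_abs]
  calc _ ≤ (γ : ℝ) ^ t * (A * ((t : ℝ) + 1) ^ 2) :=
        mul_le_mul_of_nonneg_left (ha t) (pow_nonneg γ.2.1.le t)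
    _ = _ := by ring

theorem one_le_succ_sq (t : ℕ) : (1 : ℝ) ≤ ((t : ℝ) + 1) ^ 2 := by
  nlinarith [(Nat.cast_nonneg t : (0 : ℝ) ≤ t)]

theorem succ_le_succ_sq (t : ℕ) : (t : ℝ) + 1 ≤ ((t : ℝ) + 1) ^ 2 := by
  nlinarith [(Nat.cast_nonneg t : (0 : ℝ) ≤ t)]

/-- `E_θ[r̄_t ⟨∇ log-likelihood up to time t, h⟩]`. -/
def rewardScore (M : Model.{u, v, w} G d κp κr) (θ h : Params V d) (t : ℕ) : ℝ :=
  expect (M.trajectory (fun _ => θ) t) fun x => M.avgReward (x (Fin.last t)) * M.pathScore θ h x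

theorem abs_reward_mul_pathScore_le {R : ℝ} (hR : 0 ≤ R) (hB : 0 ≤ B) (hL : 0 ≤ L)
    (hs : M.ScoreBound B) (hl : M.ScoreLipschitz L) {g : M.Pair → ℝ} (hg : ∀ x, |g x| ≤ R)
    (θ h : Params V d) (t : ℕ) (x : Fin (t + 1) → M.Pair) :
    |g (x (Fin.last t)) * M.pathScore θ h x| ≤
      R * ((t + 1) * (Fintype.card V * (Fintype.card V * B * ‖h‖))) := by
  rw [abs_mul]
  exact mul_le_mul (hg _) (abs_pathScore_le hB hL hs hl θ h x) (abs_nonneg _) hR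

theorem abs_rewardScore_le {R : ℝ} (hR : 0 ≤ R) (hB : 0 ≤ B) (hL : 0 ≤ L) (hr : M.RewardBound R)
    (hs : M.ScoreBound B) (hl : M.ScoreLipschitz L) (θ h : Params V d) (t : ℕ) :
    |M.rewardScore θ h t| ≤
      R * (Fintype.card V * (Fintype.card V * B)) * ‖h‖ * ((t : ℝ) + 1) ^ 2 := by
  refine (abs_expect_le _ (abs_reward_mul_pathScore_le hR hB hL hs hl
    (abs_avgReward_le hR hr) θ h t)).trans ?_
  calc _ = R * (Fintype.card V * (Fintype.card V * B)) * ‖h‖ * ((t : ℝ) + 1) := by ring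
    _ ≤ _ := mul_le_mul_of_nonneg_left (succ_le_succ_sq t) (by positivity)

theorem rewardScore_add {R : ℝ} (hR : 0 ≤ R) (hB : 0 ≤ B) (hL : 0 ≤ L) (hr : M.RewardBound R)
    (hs : M.ScoreBound B) (hl : M.ScoreLipschitz L) (θ h h' : Params V d) (t : ℕ) :
    M.rewardScore θ (h + h') t = M.rewardScore θ h t + M.rewardScore θ h' t := by
  simp only [rewardScore, pathScore_add, mul_add]
  exact expect_add _ (abs_reward_mul_pathScore_le hR hB hL hs hl (abs_avgReward_le hR hr) θ h t)
    (abs_reward_mul_pathScore_le hR hB hL hs hl (abs_avgReward_le hR hr) θ h' t)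

theorem rewardScore_smul (θ : Params V d) (c : ℝ) (h : Params V d) (t : ℕ) :
    M.rewardScore θ (c • h) t = c * M.rewardScore θ h t := by
  simp only [rewardScore, pathScore_smul, ← expect_const_mul]
  congr 1
  funext x
  ring

/-- The bound on the norm of `∇J`. -/
def gradJConst (N : ℕ) (γ R B : ℝ) : ℝ := R * (N * (N * B)) * sqGeom γ

theorem gradJConst_nonneg (N : ℕ) (γ : Set.Ioo (0 : ℝ) 1) {R B : ℝ} (hR : 0 ≤ R) (hB : 0 ≤ B) :
    0 ≤ gradJConst N γ R B := mul_nonneg (by positivity) (sqGeom_nonneg γ)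

/-- The constant of the quadratic remainder of `J`. -/
def smoothConst (N : ℕ) (γ R B L : ℝ) : ℝ := R * remConst N B L * sqGeom γ

theorem smoothConst_nonneg (N : ℕ) (γ : Set.Ioo (0 : ℝ) 1) {R B L : ℝ} (hR : 0 ≤ R) (hL : 0 ≤ L) :
    0 ≤ smoothConst N γ R B L :=
  mul_nonneg (mul_nonneg hR (remConst_nonneg N hL)) (sqGeom_nonneg γ)

theorem abs_expect_reward_le {R : ℝ} (hR : 0 ≤ R) (hr : M.RewardBound R) (θ : Params V d) (t : ℕ) :
    |expect (M.trajectory (fun _ => θ) t) fun x => M.avgReward (x (Fin.last t))| ≤ R :=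
  abs_expect_le _ fun _ => abs_avgReward_le hR hr _

theorem abs_J_le (γ : Set.Ioo (0 : ℝ) 1) {R : ℝ} (hR : 0 ≤ R) (hr : M.RewardBound R)
    (θ : Params V d) : |M.J γ θ| ≤ R * sqGeom γ := by
  rw [J_eq]
  refine abs_tsum_pow_mul_le γ fun t => ?_
  exact (abs_expect_reward_le hR hr θ t).trans (le_mul_of_one_le_right hR (one_le_succ_sq t))

theorem abs_J_sub_sub_le (γ : Set.Ioo (0 : ℝ) 1) {R : ℝ} (hR : 0 ≤ R) (hB : 0 ≤ B) (hL : 0 ≤ L)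
    (hr : M.RewardBound R) (hs : M.ScoreBound B) (hl : M.ScoreLipschitz L) (θ θ' : Params V d) :
    |M.J γ θ' - M.J γ θ - ∑' t : ℕ, (γ : ℝ) ^ t * M.rewardScore θ (θ' - θ) t| ≤
      smoothConst (Fintype.card V) γ R B L * ‖θ' - θ‖ ^ 2 := by
  have h1 : ∀ θ : Params V d, Summable fun t : ℕ => (γ : ℝ) ^ t *
      expect (M.trajectory (fun _ => θ) t) fun x => M.avgReward (x (Fin.last t)) := fun θ =>
    summable_pow_mul γ fun t => (abs_expect_reward_le hR hr θ t).trans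
      (le_mul_of_one_le_right hR (one_le_succ_sq t))
  have h2 := summable_pow_mul γ (abs_rewardScore_le hR hB hL hr hs hl θ (θ' - θ))
  rw [J_eq, J_eq, ← (h1 θ').tsum_sub (h1 θ), ← ((h1 θ').sub (h1 θ)).tsum_sub h2]
  have h3 : smoothConst (Fintype.card V) γ R B L * ‖θ' - θ‖ ^ 2 =
      R * remConst (Fintype.card V) B L * ‖θ' - θ‖ ^ 2 * sqGeom γ := by rw [smoothConst]; ring
  rw [h3]
  simp_rw [← mul_sub]
  refine abs_tsum_pow_mul_le γ fun t => ?_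
  refine (abs_expect_trajectory_sub_sub_le hB hL hs hl θ θ' t
    (f := fun x => M.avgReward (x (Fin.last t))) fun x => abs_avgReward_le hR hr _).trans
    (le_of_eq (by ring))

/-- The policy gradient theorem: `J` is differentiable, and its derivative in direction `h` is
`∑ γᵗ E_θ[r̄_t ⟨∇ log-likelihood up to time t, h⟩]`. -/
theorem hasGradientAt_J (γ : Set.Ioo (0 : ℝ) 1) {R : ℝ} (hR : 0 ≤ R) (hB : 0 ≤ B) (hL : 0 ≤ L)
    (hr : M.RewardBound R) (hs : M.ScoreBound B) (hl : M.ScoreLipschitz L) (θ : Params V d) :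
    DifferentiableAt ℝ (M.J γ) θ ∧ ∀ h : Params V d, inner ℝ (gradient (M.J γ) θ) h =
      ∑' t : ℕ, (γ : ℝ) ^ t * M.rewardScore θ h t := by
  have hsum := fun h => summable_pow_mul γ (abs_rewardScore_le hR hB hL hr hs hl θ h)
  refine hasGradientAt_of_quadratic_remainder
    (D := fun h => ∑' t : ℕ, (γ : ℝ) ^ t * M.rewardScore θ h t)
    (fun h h' => ?_) (fun c h => ?_) (A := gradJConst (Fintype.card V) γ R B) (fun h => ?_)
    (abs_J_sub_sub_le γ hR hB hL hr hs hl θ)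
  · rw [← (hsum h).tsum_add (hsum h')]
    exact tsum_congr fun t => by rw [rewardScore_add hR hB hL hr hs hl, mul_add]
  · rw [← tsum_mul_left]
    exact tsum_congr fun t => by rw [rewardScore_smul]; ring
  · refine (abs_tsum_pow_mul_le γ (abs_rewardScore_le hR hB hL hr hs hl θ h)).trans
      (le_of_eq ?_)
    rw [gradJConst]; ring

theorem norm_gradient_J_le (γ : Set.Ioo (0 : ℝ) 1) {R : ℝ} (hR : 0 ≤ R) (hB : 0 ≤ B) (hL : 0 ≤ L)
    (hr : M.RewardBound R) (hs : M.ScoreBound B) (hl : M.ScoreLipschitz L) (θ : Params V d) :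
    ‖gradient (M.J γ) θ‖ ≤ gradJConst (Fintype.card V) γ R B := by
  set g := gradient (M.J γ) θ with hg
  have h1 := (hasGradientAt_J γ hR hB hL hr hs hl θ).2 g
  have h2 := abs_tsum_pow_mul_le γ (abs_rewardScore_le hR hB hL hr hs hl θ g)
  rw [← h1, ← hg, real_inner_self_eq_norm_sq, abs_of_nonneg (sq_nonneg _)] at h2
  rcases (norm_nonneg g).eq_or_lt with h | h
  · rw [← h]
    exact gradJConst_nonneg _ γ hR hB
  · rw [gradJConst]
    nlinarith

theorem J_add_le (γ : Set.Ioo (0 : ℝ) 1) {R : ℝ} (hR : 0 ≤ R) (hB : 0 ≤ B) (hL : 0 ≤ L)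
    (hr : M.RewardBound R) (hs : M.ScoreBound B) (hl : M.ScoreLipschitz L) (θ h : Params V d) :
    |M.J γ (θ + h) - M.J γ θ - inner ℝ (gradient (M.J γ) θ) h| ≤
      smoothConst (Fintype.card V) γ R B L * ‖h‖ ^ 2 := by
  have h1 := abs_J_sub_sub_le γ hR hB hL hr hs hl θ (θ + h)
  rwa [add_sub_cancel_left, ← (hasGradientAt_J γ hR hB hL hr hs hl θ).2 h] at h1

end Model

/-! ### Locality of the reward processes -/

section Locality

variable {V : Type w} [Fintype V] {G : SimpleGraph V} {d κp κr : ℕ}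

theorem eq_zero_of_abs_mul_le_sq {a K : ℝ} (h : ∀ c : ℝ, |c * a| ≤ K * c ^ 2) : a = 0 := by
  by_contra ha
  have ha' : 0 < |a| := abs_pos.2 ha
  have hK : |a| ≤ K := by simpa using h 1
  have hK0 : 0 < K := ha'.trans_le hK
  have h1 := h (|a| / (2 * K))
  rw [abs_mul, abs_of_pos (by positivity)] at h1
  have h2 : K * (|a| / (2 * K)) ^ 2 = |a| / (2 * K) * |a| / 2 := by field_simp
  rw [h2] at h1
  have h3 : 0 < |a| / (2 * K) * |a| := by positivity
  linarith

namespace Model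

variable {M : Model.{u, v, w} G d κp κr}

/-- The states and actions of the agents in `S`. -/
def restrictPair (M : Model.{u, v, w} G d κp κr) (S : Finset V) (x : M.Pair) :
    (∀ i : S, M.State i) × (∀ i : S, M.Action i) :=
  (fun i => x.1 i, fun i => x.2 i)

/-- The law of the local states and actions of `S` when the local states are drawn from `μ` and
the agents in `S` act at the parameters `Φ`. -/
def localAction (M : Model.{u, v, w} G d κp κr) (S : Finset V) (Φ : V → Params V d)
    (μ : PMF (∀ i : S, M.State i)) : PMF ((∀ i : S, M.State i) × (∀ i : S, M.Action i)) :=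
  μ.bind fun s => (prodPMF fun i : S => M.policy i (s i) (Φ i)).map fun a => (s, a)

theorem map_restrictPair_withAction (S : Finset V) (Φ : V → Params V d)
    (μ : PMF (∀ i, M.State i)) :
    (M.withAction Φ μ).map (M.restrictPair S) =
      M.localAction S Φ (μ.map fun s (i : S) => s i) := by
  rw [withAction, localAction, PMF.map_bind, PMF.bind_map]
  congr 1
  funext s
  rw [PMF.map_comp, Function.comp_apply, ← map_restrict_prodPMF (fun i => M.policy i (s i) (Φ i)) S,
    PMF.map_comp]
  rfl

/-- The law at time `t` of the states and actions of the agents in `S` depends only on the policies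
of these agents, because transitions and policies are local. -/
theorem map_restrictPair_trajectory_congr {S : Finset V} {Φ Ψ : V → Params V d}
    (h : ∀ i ∈ S, ∀ s, M.policy i s (Φ i) = M.policy i s (Ψ i)) (t : ℕ) :
    ((M.trajectory Φ t).map fun x => x (Fin.last t)).map (M.restrictPair S) =
      ((M.trajectory Ψ t).map fun x => x (Fin.last t)).map (M.restrictPair S) := by
  have hloc : ∀ μ, M.localAction S Φ μ = M.localAction S Ψ μ := by
    intro μ
    rw [localAction, localAction]
    congr 1
    funext s
    congr 2
    funext i
    exact h i i.2 (s i)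
  induction t with
  | zero =>
    rw [trajectory, trajectory, map_last_chainPath_zero, map_last_chainPath_zero,
      map_restrictPair_withAction, map_restrictPair_withAction, hloc]
  | succ t ih =>
    have hstep : ∀ Ξ : V → Params V d,
        ((M.trajectory Ξ (t + 1)).map fun x => x (Fin.last (t + 1))).map (M.restrictPair S) =
          (((M.trajectory Ξ t).map fun x => x (Fin.last t)).map (M.restrictPair S)).bind
            fun y => M.localAction S Ξ (prodPMF fun i : S => M.trans i (y.1 i) (y.2 i)) := by
      intro Ξ
      rw [trajectory, map_last_chainPath_succ]
      simp only [PMF.map_bind, PMF.bind_map]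
      congr 1
      funext x
      simp only [Function.comp_apply]
      rw [map_restrictPair_withAction, map_restrict_prodPMF]
      rfl
    rw [hstep Φ, hstep Ψ, ih]
    simp_rw [hloc]

theorem expect_reward_congr {R : ℝ} (hr : M.RewardBound R) (l : V) {Φ Ψ : V → Params V d}
    (h : ∀ i ∈ hop G κr l, ∀ s, M.policy i s (Φ i) = M.policy i s (Ψ i)) (t : ℕ) :
    expect (M.trajectory Φ t) (fun x => M.reward l (x (Fin.last t)).1 (x (Fin.last t)).2) =
      expect (M.trajectory Ψ t) fun x => M.reward l (x (Fin.last t)).1 (x (Fin.last t)).2 := by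
  classical
  set S := hop G κr l
  set g := Function.extend (M.restrictPair S) (fun x => M.reward l x.1 x.2) 0 with hgdef
  have hfac : Function.FactorsThrough (fun x : M.Pair => M.reward l x.1 x.2) (M.restrictPair S) :=
    fun x y hxy => M.reward_local l _ _ _ _ fun j hj =>
      ⟨congrFun (congrArg Prod.fst hxy) ⟨j, hj⟩, congrFun (congrArg Prod.snd hxy) ⟨j, hj⟩⟩
  have hg : ∀ x : M.Pair, M.reward l x.1 x.2 = g (M.restrictPair S x) := fun x =>
    (hfac.extend_apply 0 x).symm
  have hgb : ∀ y, |g y| ≤ R := by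
    intro y
    by_cases hy : ∃ x, M.restrictPair S x = y
    · obtain ⟨x, rfl⟩ := hy
      rw [← hg]
      exact hr _ _ _
    · obtain ⟨x, -⟩ := (M.trajectory Φ 0).support_nonempty
      rw [hgdef, Function.extend_apply' _ _ _ hy, Pi.zero_apply, abs_zero]
      exact hr.nonneg l (x 0)
  have hE : ∀ Ξ : V → Params V d,
      expect (M.trajectory Ξ t) (fun x => M.reward l (x (Fin.last t)).1 (x (Fin.last t)).2) =
        expect (((M.trajectory Ξ t).map fun x => x (Fin.last t)).map (M.restrictPair S)) g := by
    intro Ξ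
    rw [expect_map _ _ hgb, expect_map (f := fun a => g (M.restrictPair S a)) _ _ fun a => hgb _]
    simp only [hg]
  rw [hE, hE, map_restrictPair_trajectory_congr h t]

/-- Rewards outside the `(κp + κr)`-hop neighbourhood of agent `i` are uncorrelated with the score
in the block `θ_i`: their expectations do not depend on `θ_i`, so that their derivatives vanish. -/
theorem expect_reward_mul_pathScore_eq_zero {R B L : ℝ} (hB : 0 ≤ B) (hL : 0 ≤ L)
    (hr : M.RewardBound R) (hs : M.ScoreBound B) (hl : M.ScoreLipschitz L) {i l : V}
    (hil : l ∉ hop G (κp + κr) i) (θ : Params V d) (z : EuclideanSpace ℝ (Fin d)) (t : ℕ) :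
    expect (M.trajectory (fun _ => θ) t) (fun x =>
      M.reward l (x (Fin.last t)).1 (x (Fin.last t)).2 * M.pathScore θ (setBlock 0 i z) x) = 0 := by
  set h : Params V d := setBlock 0 i z with hh
  refine eq_zero_of_abs_mul_le_sq
    (K := R * remConst (Fintype.card V) B L * ((t : ℝ) + 1) ^ 2 * ‖h‖ ^ 2) fun c => ?_
  have h1 := abs_expect_trajectory_sub_sub_le hB hL hs hl θ (θ + c • h) t
    (f := fun x => M.reward l (x (Fin.last t)).1 (x (Fin.last t)).2) (fun x => hr _ _ _)
  rw [expect_reward_congr hr l (Φ := fun _ => θ + c • h) (Ψ := fun _ => θ), sub_self, zero_sub,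
    abs_neg, add_sub_cancel_left, norm_smul, mul_pow, Real.norm_eq_abs, sq_abs] at h1
  · rw [← expect_const_mul]
    refine le_trans (le_of_eq ?_) (h1.trans (le_of_eq (by ring)))
    congr 2
    funext x
    rw [pathScore_smul]
    ring
  · intro j hj s
    refine M.policy_local j s _ _ fun k hk => ?_
    have hki : k ≠ i := by
      rintro rfl
      exact hil (mem_hop_add G ((mem_hop_comm G).1 hk) ((mem_hop_comm G).1 hj))
    rw [PiLp.add_apply, PiLp.smul_apply, hh, setBlock_apply_of_ne _ hki]
    simp

end Model

end Locality

/-! ### The mean of the gradient estimates -/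

theorem tsum_tsum_eq_tsum_sum_antidiagonal {F : ℕ × ℕ → ℝ} (hF : Summable F) :
    ∑' a, ∑' b, F (a, b) = ∑' n, ∑ p ∈ Finset.HasAntidiagonal.antidiagonal n, F p := by
  have hF' := (Finset.HasAntidiagonal.sigmaAntidiagonalEquivProd (A := ℕ)).summable_iff.2 hF
  rw [← hF.tsum_prod, ← Finset.HasAntidiagonal.sigmaAntidiagonalEquivProd.tsum_eq F]
  refine hF'.tsum_sigma.trans (tsum_congr fun n => ?_)
  rw [tsum_fintype, ← Finset.sum_coe_sort (Finset.HasAntidiagonal.antidiagonal n)]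
  rfl

theorem expect_geomPMF (q : Set.Ioo (0 : ℝ) 1) (f : ℕ → ℝ) :
    expect (geomPMF q) f = ∑' k, (1 - (q : ℝ)) * (q : ℝ) ^ k * f k := by
  refine tsum_congr fun k => ?_
  have : (geomPMF q k).toReal = (1 - (q : ℝ)) * (q : ℝ) ^ k :=
    ENNReal.toReal_ofReal (mul_nonneg (sub_nonneg.2 q.2.2.le) (pow_nonneg q.2.1.le k))
  rw [this]

/-- A discounted sum truncated at an independent geometric time is an unbiased estimate of the sum
with twice the discount: `P(T ≥ τ) = q ^ τ`. -/
theorem expect_geomPMF_sum (q : Set.Ioo (0 : ℝ) 1) {b : ℕ → ℝ} {A : ℝ} (hb : ∀ k, |b k| ≤ A) :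
    expect (geomPMF q) (fun n => ∑ τ : Fin (n + 1), (q : ℝ) ^ (τ : ℕ) * b τ) =
      ∑' τ : ℕ, (q : ℝ) ^ (2 * τ) * b τ := by
  have hq0 : (0 : ℝ) ≤ q := q.2.1.le
  have hg := hasSum_geometric_of_lt_one hq0 q.2.2
  have hs1 : Summable fun k : ℕ => ‖(q : ℝ) ^ k‖ := by
    simpa only [norm_pow, Real.norm_of_nonneg hq0] using hg.summable
  have hs2 : Summable fun k : ℕ => ‖(q : ℝ) ^ (2 * k) * b k‖ := by
    refine Summable.of_nonneg_of_le (fun _ => norm_nonneg _) (fun k => ?_)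
      (hg.summable.mul_right A)
    rw [norm_mul, Real.norm_of_nonneg (pow_nonneg hq0 _)]
    exact mul_le_mul (pow_le_pow_of_le_one hq0 q.2.2.le (by omega)) (hb k) (norm_nonneg _)
      (pow_nonneg hq0 _)
  have hc := tsum_mul_tsum_eq_tsum_sum_antidiagonal_of_summable_norm hs1 hs2
  rw [hg.tsum_eq] at hc
  have h1 : (1 - (q : ℝ)) ≠ 0 := (sub_pos.2 q.2.2).ne'
  rw [expect_geomPMF, ← mul_right_inj' (inv_ne_zero h1), hc, ← tsum_mul_left]
  refine tsum_congr fun n => ?_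
  rw [Fin.sum_univ_eq_sum_range (fun τ => (q : ℝ) ^ τ * b τ), ← Finset.sum_flip,
    Finset.Nat.sum_antidiagonal_eq_sum_range_succ
      (f := fun k l => (q : ℝ) ^ k * ((q : ℝ) ^ (2 * l) * b l)), mul_assoc (1 - (q : ℝ)),
    inv_mul_cancel_left₀ h1, Finset.mul_sum]
  refine Finset.sum_congr rfl fun k hk => ?_
  have hkn : k ≤ n := Nat.lt_succ_iff.1 (Finset.mem_range.1 hk)
  rw [← mul_assoc, ← mul_assoc, ← pow_add, ← pow_add]
  congr 2
  omega

/-- Sampling the time `T₁ ~ Geom (1 - γ)` of the score and the horizon `T₂ ~ Geom (1 - √γ)` of the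
rewards reproduces the double discounted sum. -/
theorem expect_two_horizons (γ : Set.Ioo (0 : ℝ) 1) {b : ℕ → ℕ → ℝ} {A : ℝ}
    (hb : ∀ s k, |b s k| ≤ A) :
    expect (geomPMF γ) (fun T₁ => expect (geomPMF (Model.sqrtIoo γ)) fun T₂ =>
        1 / (1 - (γ : ℝ)) * ∑ τ : Fin (T₂ + 1), √(γ : ℝ) ^ (τ : ℕ) * b T₁ τ) =
      ∑' t : ℕ, (γ : ℝ) ^ t * ∑ p ∈ Finset.HasAntidiagonal.antidiagonal t, b p.1 p.2 := by
  have hγ0 : (0 : ℝ) ≤ γ := γ.2.1.le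
  have hg := hasSum_geometric_of_lt_one hγ0 γ.2.2
  have h1 : (1 - (γ : ℝ)) ≠ 0 := (sub_pos.2 γ.2.2).ne'
  have hinner : ∀ T₁, expect (geomPMF (Model.sqrtIoo γ)) (fun T₂ =>
      1 / (1 - (γ : ℝ)) * ∑ τ : Fin (T₂ + 1), √(γ : ℝ) ^ (τ : ℕ) * b T₁ τ) =
      1 / (1 - (γ : ℝ)) * ∑' τ : ℕ, (γ : ℝ) ^ τ * b T₁ τ := by
    intro T₁
    rw [expect_const_mul]
    congr 1
    refine (expect_geomPMF_sum (Model.sqrtIoo γ) (hb T₁)).trans (tsum_congr fun τ => ?_)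
    change √(γ : ℝ) ^ (2 * τ) * _ = _
    rw [pow_mul, Real.sq_sqrt hγ0]
  have hF : Summable fun z : ℕ × ℕ => (γ : ℝ) ^ (z.1 + z.2) * b z.1 z.2 := by
    have h2 : Summable fun z : ℕ × ℕ => (γ : ℝ) ^ z.1 * (γ : ℝ) ^ z.2 :=
      hg.summable.mul_of_nonneg hg.summable (fun k => pow_nonneg hγ0 k) (fun k => pow_nonneg hγ0 k)
    refine Summable.of_norm_bounded (h2.mul_right A) fun z => ?_
    rw [norm_mul, Real.norm_of_nonneg (pow_nonneg hγ0 _), pow_add]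
    exact mul_le_mul_of_nonneg_left (hb _ _) (by positivity)
  simp_rw [hinner]
  rw [expect_geomPMF]
  calc ∑' T₁ : ℕ, (1 - (γ : ℝ)) * (γ : ℝ) ^ T₁ *
        (1 / (1 - (γ : ℝ)) * ∑' τ : ℕ, (γ : ℝ) ^ τ * b T₁ τ)
      = ∑' T₁ : ℕ, ∑' τ : ℕ, (γ : ℝ) ^ (T₁ + τ) * b T₁ τ := by
        refine tsum_congr fun T₁ => ?_
        rw [show (1 - (γ : ℝ)) * (γ : ℝ) ^ T₁ * (1 / (1 - (γ : ℝ)) * ∑' τ : ℕ, (γ : ℝ) ^ τ * b T₁ τ)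
          = (γ : ℝ) ^ T₁ * ∑' τ : ℕ, (γ : ℝ) ^ τ * b T₁ τ by field_simp, ← tsum_mul_left]
        exact tsum_congr fun τ => by rw [pow_add, mul_assoc]
    _ = _ := by
        rw [tsum_tsum_eq_tsum_sum_antidiagonal
          (F := fun z : ℕ × ℕ => (γ : ℝ) ^ (z.1 + z.2) * b z.1 z.2) hF]
        refine tsum_congr fun t => ?_
        rw [Finset.mul_sum]
        refine Finset.sum_congr rfl fun p hp => ?_
        rw [Finset.HasAntidiagonal.mem_antidiagonal.1 hp]

namespace Model

variable {V : Type w} [Fintype V] {G : SimpleGraph V} {d κp κr : ℕ} {M : Model.{u, v, w} G d κp κr}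

/-- The score in the block `θ_i` of the policies of the `κp`-hop neighbours of agent `i`. -/
def scoreAt (M : Model.{u, v, w} G d κp κr) (θ : Params V d) (i : V) (x : M.Pair) :
    EuclideanSpace ℝ (Fin d) :=
  ∑ j ∈ hop G κp i, blockGrad (M.logPolicy j (x.1 j) (x.2 j)) θ i

theorem blockDeriv_setBlock_zero (f : Params V d → ℝ) (θ : Params V d) (i : V)
    (z : EuclideanSpace ℝ (Fin d)) :
    blockDeriv f θ (setBlock 0 i z) = inner ℝ (blockGrad f θ i) z := by
  rw [blockDeriv, Finset.sum_eq_single i]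
  · rw [setBlock_apply_self]
  · intro j _ hj
    rw [setBlock_apply_of_ne 0 hj]
    simp
  · simp

theorem stepScore_setBlock_zero (θ : Params V d) (i : V) (z : EuclideanSpace ℝ (Fin d))
    (x : M.Pair) : M.stepScore θ (setBlock 0 i z) x = inner ℝ (M.scoreAt θ i x) z := by
  simp_rw [stepScore, blockDeriv_setBlock_zero, scoreAt, sum_inner]
  refine (Finset.sum_subset (Finset.subset_univ _) fun j _ hj => ?_).symm
  rw [blockGrad_logPolicy_of_notMem fun h => hj ((mem_hop_comm G).1 h), inner_zero_left]

theorem stepScore_eq_sum (θ h : Params V d) (x : M.Pair) :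
    M.stepScore θ h x = ∑ i, M.stepScore θ (setBlock 0 i (h i)) x := by
  simp_rw [stepScore, blockDeriv_setBlock_zero]
  rw [Finset.sum_comm]
  rfl

theorem pathScore_eq_sum (θ h : Params V d) {n : ℕ} (x : Fin (n + 1) → M.Pair) :
    M.pathScore θ h x = ∑ i, M.pathScore θ (setBlock 0 i (h i)) x := by
  simp_rw [pathScore]
  rw [Finset.sum_comm]
  exact Finset.sum_congr rfl fun k _ => stepScore_eq_sum θ h (x k)

theorem norm_scoreAt_le {B : ℝ} (hB : 0 ≤ B) (hs : M.ScoreBound B) (θ : Params V d) (i : V)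
    (x : M.Pair) : ‖M.scoreAt θ i x‖ ≤ Fintype.card V * B := by
  refine (norm_sum_le _ _).trans ((Finset.sum_le_sum fun j hj =>
    ((hs j _ _ θ).2 i ((mem_hop_comm G).1 hj)).2).trans ?_)
  rw [Finset.sum_const, nsmul_eq_mul]
  refine mul_le_mul_of_nonneg_right ?_ hB
  exact_mod_cast Finset.card_le_univ _

theorem norm_scoreAt_sub_le {L : ℝ} (hL : 0 ≤ L) (hl : M.ScoreLipschitz L) (θ θ' : Params V d)
    (i : V) (x : M.Pair) :
    ‖M.scoreAt θ i x - M.scoreAt θ' i x‖ ≤ Fintype.card V * (L * ‖θ - θ'‖) := by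
  rw [scoreAt, scoreAt, ← Finset.sum_sub_distrib]
  refine (norm_sum_le _ _).trans ((Finset.sum_le_sum fun j hj =>
    hl j _ _ θ θ' i ((mem_hop_comm G).1 hj)).trans ?_)
  rw [Finset.sum_const, nsmul_eq_mul]
  refine mul_le_mul_of_nonneg_right ?_ (by positivity)
  exact_mod_cast Finset.card_le_univ _

theorem abs_localReward_le {R : ℝ} (hr : M.RewardBound R) (S : Finset V) (x : M.Pair) (i : V) :
    |∑ l ∈ S, M.reward l x.1 x.2| ≤ Fintype.card V * R := by
  refine (abs_sum_reward_le hr S x).trans (mul_le_mul_of_nonneg_right ?_ (hr.nonneg i x))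
  exact_mod_cast Finset.card_le_univ _

/-- The average over the agents `i` of the products of the local reward at the pair `y` with the
score of `i` at the pair `x` in direction `h i`. Agent `i` evaluates its score at `Φ i`. -/
def crossTerm (M : Model.{u, v, w} G d κp κr) (Φ : V → Params V d) (h : Params V d)
    (x y : M.Pair) : ℝ :=
  (1 / (Fintype.card V : ℝ)) * ∑ i, (∑ l ∈ hop G (κp + κr) i, M.reward l y.1 y.2) *
    inner ℝ (M.scoreAt (Φ i) i x) (h i)

theorem abs_crossTerm_le {R B : ℝ} (hR : 0 ≤ R) (hB : 0 ≤ B) (hr : M.RewardBound R)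
    (hs : M.ScoreBound B) (Φ : V → Params V d) (h : Params V d) (x y : M.Pair) :
    |M.crossTerm Φ h x y| ≤ Fintype.card V * R * (Fintype.card V * B * ‖h‖) := by
  refine abs_avg_le (by positivity) fun i => ?_
  rw [abs_mul]
  refine mul_le_mul (abs_localReward_le hr _ y i) ((abs_inner_le _ _).trans ?_) (abs_nonneg _)
    (by positivity)
  exact mul_le_mul (norm_scoreAt_le hB hs _ i x) (norm_block_le h i) (norm_nonneg _)
    (by positivity)

theorem abs_crossTerm_sub_le {R L : ℝ} (hR : 0 ≤ R) (hL : 0 ≤ L) (hr : M.RewardBound R)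
    (hl : M.ScoreLipschitz L) {Φ Ψ : V → Params V d} {ε : ℝ} (hε0 : 0 ≤ ε)
    (hε : ∀ i, ‖Φ i - Ψ i‖ ≤ ε) (h : Params V d) (x y : M.Pair) :
    |M.crossTerm Φ h x y - M.crossTerm Ψ h x y| ≤
      Fintype.card V * R * (Fintype.card V * (L * ε) * ‖h‖) := by
  rw [crossTerm, crossTerm, ← mul_sub, ← Finset.sum_sub_distrib]
  refine abs_avg_le (by positivity) fun i => ?_
  rw [← mul_sub, ← inner_sub_left, abs_mul]
  refine mul_le_mul (abs_localReward_le hr _ y i) ((abs_inner_le _ _).trans ?_) (abs_nonneg _)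
    (by positivity)
  refine mul_le_mul ((norm_scoreAt_sub_le hL hl _ _ i x).trans ?_) (norm_block_le h i)
    (norm_nonneg _) (by positivity)
  exact mul_le_mul_of_nonneg_left (mul_le_mul_of_nonneg_left (hε i) hL) (by positivity)

/-- The mean of `crossTerm` for the score at time `u ≤ t` and the rewards at time `t`. (For `u > t`
the score at time `t` is taken.) -/
def crossMean (M : Model.{u, v, w} G d κp κr) (Φ : V → Params V d) (h : Params V d) (u t : ℕ) : ℝ :=
  expect (M.trajectory Φ t) fun x =>
    M.crossTerm Φ h (x ⟨min u t, Nat.lt_succ_of_le (min_le_right u t)⟩) (x (Fin.last t))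

/-- The Lipschitz constant of `crossMean` in the parameters that the agents use. -/
def biasConst (N : ℕ) (R B L : ℝ) : ℝ :=
  2 * (N * R * (N * B)) * (N * (N * B)) + N * R * (N * L)

theorem biasConst_nonneg (N : ℕ) {R B L : ℝ} (hR : 0 ≤ R) (hB : 0 ≤ B) (hL : 0 ≤ L) :
    0 ≤ biasConst N R B L := by
  rw [biasConst]; positivity

theorem abs_crossMean_sub_le {R B L : ℝ} (hR : 0 ≤ R) (hB : 0 ≤ B) (hL : 0 ≤ L)
    (hr : M.RewardBound R) (hs : M.ScoreBound B) (hl : M.ScoreLipschitz L) {Φ Ψ : V → Params V d}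
    {ε : ℝ} (hε0 : 0 ≤ ε) (hε : ∀ i, ‖Φ i - Ψ i‖ ≤ ε) (h : Params V d) (u t : ℕ) :
    |M.crossMean Φ h u t - M.crossMean Ψ h u t| ≤
      biasConst (Fintype.card V) R B L * ε * ‖h‖ * ((t : ℝ) + 1) := by
  rw [crossMean, crossMean]
  generalize (⟨min u t, Nat.lt_succ_of_le (min_le_right u t)⟩ : Fin (t + 1)) = k
  have h1 := abs_expect_trajectory_sub_le hB hL hs hl hε t
    (f := fun x => M.crossTerm Φ h (x k) (x (Fin.last t)))
    fun x => abs_crossTerm_le hR hB hr hs Φ h (x k) (x (Fin.last t))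
  have h2 : |expect (M.trajectory Ψ t) (fun x => M.crossTerm Φ h (x k) (x (Fin.last t))) -
      expect (M.trajectory Ψ t) (fun x => M.crossTerm Ψ h (x k) (x (Fin.last t)))| ≤
      Fintype.card V * R * (Fintype.card V * (L * ε) * ‖h‖) := by
    rw [← expect_sub (f := fun x => M.crossTerm Φ h (x k) (x (Fin.last t)))
      (g := fun x => M.crossTerm Ψ h (x k) (x (Fin.last t))) (M.trajectory Ψ t)
      (fun x => abs_crossTerm_le hR hB hr hs Φ h (x k) (x (Fin.last t)))
      fun x => abs_crossTerm_le hR hB hr hs Ψ h (x k) (x (Fin.last t))]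
    exact abs_expect_le _ fun x => abs_crossTerm_sub_le hR hL hr hl hε0 hε h _ _
  have h3 := (_root_.abs_sub_le _ _ _).trans (add_le_add h1 h2)
  refine h3.trans ?_
  have h4 : (Fintype.card V : ℝ) * R * (Fintype.card V * (L * ε) * ‖h‖) ≤
      Fintype.card V * R * (Fintype.card V * (L * ε) * ‖h‖) * ((t : ℝ) + 1) :=
    le_mul_of_one_le_right (by positivity) (by linarith [(Nat.cast_nonneg t : (0 : ℝ) ≤ t)])
  rw [biasConst]
  linarith

theorem sum_inner_gradEst (γ : Set.Ioo (0 : ℝ) 1) (Φ : V → Params V d) (h : Params V d)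
    (ω : M.Sample) :
    ∑ i, inner ℝ (ω.gradEst γ (Φ i) i) (h i) = 1 / (1 - (γ : ℝ)) *
      ∑ τ : Fin (ω.T₂ + 1), √(γ : ℝ) ^ (τ : ℕ) *
        M.crossTerm Φ h (ω.path ⟨ω.T₁, by omega⟩) (ω.path ⟨ω.T₁ + τ, by omega⟩) := by
  have h1 : ∀ i, inner ℝ (ω.gradEst γ (Φ i) i) (h i) = 1 / (1 - (γ : ℝ)) *
      ∑ τ : Fin (ω.T₂ + 1), √(γ : ℝ) ^ (τ : ℕ) * ((1 / (Fintype.card V : ℝ)) *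
        ((∑ l ∈ hop G (κp + κr) i, M.reward l (ω.path ⟨ω.T₁ + τ, by omega⟩).1
          (ω.path ⟨ω.T₁ + τ, by omega⟩).2) *
          inner ℝ (M.scoreAt (Φ i) i (ω.path ⟨ω.T₁, by omega⟩)) (h i))) := by
    intro i
    rw [Sample.gradEst, real_inner_smul_left, Sample.qEst, mul_assoc]
    congr 1
    change _ * inner ℝ (M.scoreAt (Φ i) i (ω.path ⟨ω.T₁, by omega⟩)) (h i) = _
    rw [mul_assoc, Finset.sum_mul, Finset.mul_sum]
    refine Finset.sum_congr rfl fun τ _ => ?_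
    rw [rpow_half_eq_sqrt_pow γ.2.1.le]
    ring
  simp_rw [h1, ← Finset.mul_sum]
  rw [Finset.sum_comm]
  congr 1
  refine Finset.sum_congr rfl fun τ _ => ?_
  rw [crossTerm, ← Finset.mul_sum, ← Finset.mul_sum]

theorem expect_sampleLaw (γ : Set.Ioo (0 : ℝ) 1) (Φ : V → Params V d) {f : M.Sample → ℝ} {K : ℝ}
    (hf : ∀ ω, |f ω| ≤ K) :
    expect (M.sampleLaw γ Φ) f = expect (geomPMF γ) fun T₁ =>
      expect (geomPMF (sqrtIoo γ)) fun T₂ =>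
        expect (M.trajectory Φ (T₁ + T₂)) fun x => f ⟨T₁, T₂, x⟩ := by
  rw [sampleLaw, expect_bind _ _ hf]
  congr 1
  funext T₁
  rw [expect_bind _ _ hf]
  congr 1
  funext T₂
  rw [expect_map _ _ hf]

theorem abs_sum_inner_gradEst_le (γ : Set.Ioo (0 : ℝ) 1) {R B : ℝ} (hB : 0 ≤ B)
    (hr : M.RewardBound R) (hs : M.ScoreBound B) (Φ : V → Params V d) (h : Params V d)
    (ω : M.Sample) :
    |∑ i, inner ℝ (ω.gradEst γ (Φ i) i) (h i)| ≤ Fintype.card V *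
      (gradConst γ R B * (maxHop G κp * maxHop G (κp + κr)) * ‖h‖) :=
  abs_sum_univ_le fun i => (abs_inner_le _ _).trans <|
    mul_le_mul (norm_gradEst_le γ hB hr hs ω _ i) (norm_block_le h i) (norm_nonneg _)
      ((norm_nonneg _).trans (norm_gradEst_le γ hB hr hs ω (Φ i) i))

theorem expect_sampleLaw_gradEst (γ : Set.Ioo (0 : ℝ) 1) {R B : ℝ} (hR : 0 ≤ R) (hB : 0 ≤ B)
    (hr : M.RewardBound R) (hs : M.ScoreBound B) (Φ : V → Params V d) (h : Params V d) :
    expect (M.sampleLaw γ Φ) (fun ω => ∑ i, inner ℝ (ω.gradEst γ (Φ i) i) (h i)) =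
      ∑' t : ℕ, (γ : ℝ) ^ t * ∑ u ∈ Finset.range (t + 1), M.crossMean Φ h u t := by
  have hb : ∀ u t, |M.crossMean Φ h u t| ≤ Fintype.card V * R * (Fintype.card V * B * ‖h‖) :=
    fun u t => abs_expect_le _ fun x => abs_crossTerm_le hR hB hr hs Φ h _ _
  rw [expect_sampleLaw γ Φ (abs_sum_inner_gradEst_le γ hB hr hs Φ h)]
  have hpath : ∀ T₁ T₂ : ℕ, expect (M.trajectory Φ (T₁ + T₂)) (fun x =>
      ∑ i, inner ℝ ((⟨T₁, T₂, x⟩ : M.Sample).gradEst γ (Φ i) i) (h i)) =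
      1 / (1 - (γ : ℝ)) * ∑ τ : Fin (T₂ + 1), √(γ : ℝ) ^ (τ : ℕ) *
        M.crossMean Φ h T₁ (T₁ + τ) := by
    intro T₁ T₂
    have hsum : ∀ x : Fin (T₁ + T₂ + 1) → M.Pair,
        ∑ i, inner ℝ ((⟨T₁, T₂, x⟩ : M.Sample).gradEst γ (Φ i) i) (h i) = 1 / (1 - (γ : ℝ)) *
          ∑ τ : Fin (T₂ + 1), √(γ : ℝ) ^ (τ : ℕ) *
            M.crossTerm Φ h (x ⟨T₁, by omega⟩) (x ⟨T₁ + τ, by omega⟩) :=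
      fun x => sum_inner_gradEst γ Φ h ⟨T₁, T₂, x⟩
    simp_rw [hsum]
    rw [expect_const_mul, expect_sum (f := fun (τ : Fin (T₂ + 1)) (x : Fin (T₁ + T₂ + 1) → M.Pair) => √(γ : ℝ) ^ (τ : ℕ) *
      M.crossTerm Φ h (x ⟨T₁, by omega⟩) (x ⟨T₁ + τ, by omega⟩))
      (K := fun τ => √(γ : ℝ) ^ (τ : ℕ) * (Fintype.card V * R * (Fintype.card V * B * ‖h‖)))]
    · congr 1
      refine Finset.sum_congr rfl fun τ _ => ?_
      rw [expect_const_mul, crossMean]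
      have hτ : T₁ + (τ : ℕ) ≤ T₁ + T₂ := Nat.add_le_add_left (Nat.lt_succ_iff.1 τ.2) _
      rw [trajectory, trajectory, ← expect_chainPath_prefix _ _ hτ
        fun x => abs_crossTerm_le hR hB hr hs Φ h _ _]
      congr 2
      funext x
      congr 2
      exact Fin.ext (min_eq_left (Nat.le_add_right T₁ τ)).symm
    · intro τ x
      rw [abs_mul, abs_of_nonneg (by positivity)]
      exact mul_le_mul_of_nonneg_left (abs_crossTerm_le hR hB hr hs Φ h _ _) (by positivity)
  simp_rw [hpath]
  rw [expect_two_horizons γ (b := fun u τ => M.crossMean Φ h u (u + τ)) fun u τ => hb u (u + τ)]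
  refine tsum_congr fun t => ?_
  rw [Finset.Nat.sum_antidiagonal_eq_sum_range_succ
    (f := fun u τ => M.crossMean Φ h u (u + τ))]
  congr 1
  refine Finset.sum_congr rfl fun u hu => ?_
  rw [Nat.add_sub_cancel' (Nat.lt_succ_iff.1 (Finset.mem_range.1 hu))]

/-- When all agents use the same parameter, the mean of the local reward-score products is the
derivative of the mean of the full reward, because far rewards do not see the block `θ_i`. -/
theorem sum_crossMean_eq_rewardScore {R B L : ℝ} (hR : 0 ≤ R) (hB : 0 ≤ B) (hL : 0 ≤ L)
    (hr : M.RewardBound R) (hs : M.ScoreBound B) (hl : M.ScoreLipschitz L) (θ h : Params V d)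
    (t : ℕ) :
    ∑ u ∈ Finset.range (t + 1), M.crossMean (fun _ => θ) h u t = M.rewardScore θ h t := by
  set p := M.trajectory (fun _ => θ) t
  set r : V → (Fin (t + 1) → M.Pair) → ℝ :=
    fun l x => M.reward l (x (Fin.last t)).1 (x (Fin.last t)).2
  set g : V → (Fin (t + 1) → M.Pair) → ℝ := fun i x => M.pathScore θ (setBlock 0 i (h i)) x
  obtain ⟨K, hK⟩ : ∃ K : V → V → ℝ, ∀ i l x, |r l x * g i x| ≤ K i l :=
    ⟨fun i l => _, fun i l x => abs_reward_mul_pathScore_le hR hB hL hs hl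
      (g := fun y => M.reward l y.1 y.2) (fun y => hr l _ _) θ (setBlock 0 i (h i)) t x⟩
  have hlhs : ∑ u ∈ Finset.range (t + 1), M.crossMean (fun _ => θ) h u t =
      (1 / (Fintype.card V : ℝ)) * ∑ i, ∑ l ∈ hop G (κp + κr) i,
        expect p fun x => r l x * g i x := by
    have h1 : ∀ i, ∑ l ∈ hop G (κp + κr) i, expect p (fun x => r l x * g i x) =
        expect p fun x => ∑ l ∈ hop G (κp + κr) i, r l x * g i x :=
      fun i => (expect_sum _ _ (hK i)).symm
    simp_rw [h1]
    rw [← expect_sum (f := fun i x => ∑ l ∈ hop G (κp + κr) i, r l x * g i x)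
      (K := fun i => ∑ l ∈ hop G (κp + κr) i, K i l), ← expect_const_mul,
      ← Fin.sum_univ_eq_sum_range (fun u => M.crossMean (fun _ => θ) h u t)]
    · simp_rw [crossMean]
      rw [← expect_sum _ _ fun u x => abs_crossTerm_le hR hB hr hs _ h _ _]
      congr 1
      funext x
      simp_rw [crossTerm]
      rw [← Finset.mul_sum, Finset.sum_comm]
      congr 1
      refine Finset.sum_congr rfl fun i _ => ?_
      rw [← Finset.sum_mul, ← Finset.mul_sum]
      congr 1
      refine Finset.sum_congr rfl fun k _ => ?_
      rw [stepScore_setBlock_zero]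
      congr 3
      exact Fin.ext (min_eq_left (Nat.lt_succ_iff.1 k.2))
    · intro i x
      exact (Finset.abs_sum_le_sum_abs _ _).trans (Finset.sum_le_sum fun l _ => hK i l x)
  have hrhs : M.rewardScore θ h t = (1 / (Fintype.card V : ℝ)) * ∑ i, ∑ l,
        expect p fun x => r l x * g i x := by
    have h1 : ∀ i, ∑ l, expect p (fun x => r l x * g i x) = expect p fun x => ∑ l, r l x * g i x :=
      fun i => (expect_sum _ _ (hK i)).symm
    simp_rw [h1]
    rw [← expect_sum (f := fun i x => ∑ l, r l x * g i x) (K := fun i => ∑ l, K i l), ← expect_const_mul, rewardScore]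
    · congr 1
      funext x
      rw [avgReward, pathScore_eq_sum, mul_assoc, Finset.mul_sum]
      congr 1
      exact Finset.sum_congr rfl fun i _ => Finset.sum_mul _ _ _
    · intro i x
      exact (Finset.abs_sum_le_sum_abs _ _).trans (Finset.sum_le_sum fun l _ => hK i l x)
  rw [hlhs, hrhs]
  congr 1
  refine Finset.sum_congr rfl fun i _ => Finset.sum_subset (Finset.subset_univ _) fun l _ hil => ?_
  exact expect_reward_mul_pathScore_eq_zero hB hL hr hs hl hil θ (h i) t

/-- The mean of the gradient estimates is `∇J`, up to an error proportional to the distance of the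
agents' estimates from the true parameter. -/
theorem abs_expect_gradEst_sub_inner_le (γ : Set.Ioo (0 : ℝ) 1) {R B L : ℝ} (hR : 0 ≤ R)
    (hB : 0 ≤ B) (hL : 0 ≤ L) (hr : M.RewardBound R) (hs : M.ScoreBound B)
    (hl : M.ScoreLipschitz L) {Φ : V → Params V d} {θ : Params V d} {ε : ℝ} (hε0 : 0 ≤ ε)
    (hε : ∀ i, ‖Φ i - θ‖ ≤ ε) (h : Params V d) :
    |expect (M.sampleLaw γ Φ) (fun ω => ∑ i, inner ℝ (ω.gradEst γ (Φ i) i) (h i)) -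
      inner ℝ (gradient (M.J γ) θ) h| ≤
      biasConst (Fintype.card V) R B L * ε * ‖h‖ * sqGeom γ := by
  have hb : ∀ (Φ : V → Params V d) (t : ℕ),
      |∑ u ∈ Finset.range (t + 1), M.crossMean Φ h u t| ≤
      Fintype.card V * R * (Fintype.card V * B * ‖h‖) * ((t : ℝ) + 1) ^ 2 := by
    intro Φ t
    refine (Finset.abs_sum_le_sum_abs _ _).trans ((Finset.sum_le_sum fun u _ =>
      abs_expect_le _ fun x => abs_crossTerm_le hR hB hr hs Φ h _ _).trans ?_)
    rw [Finset.sum_const, Finset.card_range, nsmul_eq_mul, mul_comm]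
    push_cast
    exact mul_le_mul_of_nonneg_left (succ_le_succ_sq t) (by positivity)
  rw [expect_sampleLaw_gradEst γ hR hB hr hs, (hasGradientAt_J γ hR hB hL hr hs hl θ).2]
  simp_rw [← sum_crossMean_eq_rewardScore hR hB hL hr hs hl θ h]
  rw [← (summable_pow_mul γ (hb Φ)).tsum_sub (summable_pow_mul γ (hb fun _ => θ))]
  simp_rw [← mul_sub, ← Finset.sum_sub_distrib]
  refine abs_tsum_pow_mul_le γ fun t => ?_
  refine (Finset.abs_sum_le_sum_abs _ _).trans ((Finset.sum_le_sum fun u _ =>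
    abs_crossMean_sub_le hR hB hL hr hs hl (Ψ := fun _ => θ) hε0 hε h u t).trans (le_of_eq ?_))
  rw [Finset.sum_const, Finset.card_range, nsmul_eq_mul]
  push_cast
  ring

end Model

/-! ### Expected ascent along a run -/

namespace Model

variable {V : Type w} [Fintype V] {G : SimpleGraph V} {d κp κr : ℕ} {M : Model.{u, v, w} G d κp κr}

theorem run_congr (γ : ℝ) (η : ℕ → ℝ) {ω ω' : ℕ → M.Sample} {k : ℕ} (h : ∀ l < k, ω l = ω' l) :
    M.run γ η ω k = M.run γ η ω' k := by
  induction k with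
  | zero => rfl
  | succ k ih =>
    rw [run, run, ih fun l hl => h l (hl.trans (Nat.lt_succ_self k)), h k (Nat.lt_succ_self k)]

/-- Almost every random run is a run for some realization of the samples. -/
theorem exists_run_of_mem_support (γ : Set.Ioo (0 : ℝ) 1) (η : ℕ → ℝ) (n : ℕ)
    {x : Fin (n + 1) → Iterate V d} (hx : x ∈ (M.runLaw γ η n).support) :
    ∃ ω : ℕ → M.Sample, ∀ k : Fin (n + 1), x k = M.run γ η ω k := by
  induction n with
  | zero =>
    obtain ⟨ω₀, -⟩ := (M.sampleLaw γ fun _ => 0).support_nonempty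
    rw [runLaw, chainPath, PMF.mem_support_map_iff] at hx
    obtain ⟨y, hy, rfl⟩ := hx
    rw [PMF.mem_support_pure_iff] at hy
    refine ⟨fun _ => ω₀, fun k => ?_⟩
    rw [hy, Fin.fin_one_eq_zero k]
    rfl
  | succ n ih =>
    rw [runLaw, chainPath, PMF.mem_support_bind_iff] at hx
    obtain ⟨y, hy, hxy⟩ := hx
    obtain ⟨ω, hω⟩ := ih hy
    rw [PMF.mem_support_map_iff] at hxy
    obtain ⟨z, hz, rfl⟩ := hxy
    rw [PMF.mem_support_map_iff] at hz
    obtain ⟨ω', -, rfl⟩ := hz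
    have hupd : ∀ l < n + 1, M.run γ η (Function.update ω n ω') l = M.run γ η ω l := fun l hl =>
      run_congr γ η fun m hm => Function.update_of_ne (by omega) _ _
    refine ⟨Function.update ω n ω', fun k => ?_⟩
    refine Fin.lastCases ?_ (fun k => ?_) k
    · rw [Fin.snoc_last, Fin.val_last, run, hupd n (Nat.lt_succ_self n), Function.update_self,
        hω (Fin.last n), Fin.val_last]
    · rw [Fin.snoc_castSucc, hω k]
      exact (hupd k k.2).symm

/-- The joint vector of the gradient estimates of all agents. -/
def gradVec (γ : ℝ) (Φ : V → Params V d) (ω : M.Sample) : Params V d :=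
  WithLp.toLp 2 fun i => ω.gradEst γ (Φ i) i

theorem nextθ_eq (γ η : ℝ) (x : Iterate V d) (ω : M.Sample) :
    M.nextθ γ η x ω = x.θ + η • gradVec γ (x.est G) ω := rfl

theorem norm_gradVec_le (γ : Set.Ioo (0 : ℝ) 1) {R B : ℝ} (hB : 0 ≤ B) (hr : M.RewardBound R)
    (hs : M.ScoreBound B) (Φ : V → Params V d) (ω : M.Sample) :
    ‖gradVec γ Φ ω‖ ≤
      Fintype.card V * (gradConst γ R B * (maxHop G κp * maxHop G (κp + κr))) :=
  norm_le_card_mul fun i => norm_gradEst_le γ hB hr hs ω (Φ i) i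

/-- One iteration increases `J` in the mean by `η ‖∇J‖²`, up to the error from the agents'
estimates, which are off by at most `ε`, and a term of order `η²`. -/
theorem le_expect_J_next (γ : Set.Ioo (0 : ℝ) 1) {R B L : ℝ} (hR : 0 ≤ R) (hB : 0 ≤ B) (hL : 0 ≤ L)
    (hr : M.RewardBound R) (hs : M.ScoreBound B) (hl : M.ScoreLipschitz L) {η ε : ℝ} (hη : 0 ≤ η)
    (x : Iterate V d) (hε0 : 0 ≤ ε) (hε : ∀ i, ‖x.est G i - x.θ‖ ≤ ε) :
    M.J γ x.θ + η * ‖gradient (M.J γ) x.θ‖ ^ 2 -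
        (η * (biasConst (Fintype.card V) R B L * ε * gradJConst (Fintype.card V) γ R B * sqGeom γ) +
          smoothConst (Fintype.card V) γ R B L * (η * (Fintype.card V *
            (gradConst γ R B * (maxHop G κp * maxHop G (κp + κr))))) ^ 2) ≤
      expect (M.sampleLaw γ (x.est G)) fun ω => M.J γ (M.nextθ γ η x ω) := by
  set p := M.sampleLaw γ (x.est G)
  set g := gradient (M.J γ) x.θ with hg
  set S := smoothConst (Fintype.card V) γ R B L
  set Γ := (Fintype.card V : ℝ) * (gradConst γ R B * (maxHop G κp * maxHop G (κp + κr)))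
  have hS : 0 ≤ S := smoothConst_nonneg _ γ hR hL
  set f : M.Sample → ℝ := fun ω => ∑ i, inner ℝ (ω.gradEst γ (x.est G i) i) (g i) with hf
  have hfb := abs_sum_inner_gradEst_le γ hB hr hs (x.est G) g
  have hmean := abs_expect_gradEst_sub_inner_le γ hR hB hL hr hs hl hε0 hε g
  rw [← hg, real_inner_self_eq_norm_sq] at hmean
  have hgn : ‖g‖ ≤ gradJConst (Fintype.card V) γ R B :=
    norm_gradient_J_le γ hR hB hL hr hs hl x.θ
  have hpoint : ∀ ω, M.J γ x.θ + η * f ω - S * (η * Γ) ^ 2 ≤ M.J γ (M.nextθ γ η x ω) := by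
    intro ω
    have h1 := J_add_le γ hR hB hL hr hs hl x.θ (η • gradVec γ (x.est G) ω)
    have h2 : inner ℝ g (η • gradVec γ (x.est G) ω) = η * f ω := by
      rw [inner_smul_right, PiLp.inner_apply, hf]
      congr 1
      exact Finset.sum_congr rfl fun i _ => real_inner_comm _ _
    have h3 : ‖η • gradVec γ (x.est G) ω‖ ≤ η * Γ := by
      rw [norm_smul, Real.norm_of_nonneg hη]
      exact mul_le_mul_of_nonneg_left (norm_gradVec_le γ hB hr hs _ ω) hη
    have h4 := mul_le_mul_of_nonneg_left (pow_le_pow_left₀ (norm_nonneg _) h3 2) hS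
    rw [← hg, h2, ← nextθ_eq] at h1
    linarith [(abs_le.1 h1).1]
  have hηf : ∀ ω, |η * f ω| ≤ η * (Fintype.card V *
      (gradConst γ R B * (maxHop G κp * maxHop G (κp + κr)) * ‖g‖)) := fun ω => by
    rw [abs_mul, abs_of_nonneg hη]
    exact mul_le_mul_of_nonneg_left (hfb ω) hη
  have hlow : expect p (fun ω => (M.J γ x.θ - S * (η * Γ) ^ 2) + η * f ω) ≤
      expect p fun ω => M.J γ (M.nextθ γ η x ω) := by
    refine expect_mono p (fun ω => (abs_add_le _ _).trans (add_le_add le_rfl (hηf ω)))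
      (fun ω => abs_J_le γ hR hr _) fun ω _ => ?_
    linarith [hpoint ω]
  rw [expect_add (f := fun _ => M.J γ x.θ - S * (η * Γ) ^ 2) p (fun _ => le_rfl) hηf, expect_const,
    expect_const_mul] at hlow
  have hbias : biasConst (Fintype.card V) R B L * ε * ‖g‖ * sqGeom γ ≤
      biasConst (Fintype.card V) R B L * ε * gradJConst (Fintype.card V) γ R B * sqGeom γ :=
    mul_le_mul_of_nonneg_right (mul_le_mul_of_nonneg_left hgn
      (mul_nonneg (biasConst_nonneg _ hR hB hL) hε0)) (sqGeom_nonneg γ)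
  have h5 := mul_le_mul_of_nonneg_left
    (show ‖g‖ ^ 2 - biasConst (Fintype.card V) R B L * ε * gradJConst (Fintype.card V) γ R B *
      sqGeom γ ≤ expect p f by linarith [(abs_le.1 hmean).1]) hη
  linarith

/-- The constant in the error of one iteration; `C` is the constant of the consensus error. -/
def ascentConst (N : ℕ) (γ R B c L C : ℝ) : ℝ :=
  c * (biasConst N R B L * (N * C) * gradJConst N γ R B * sqGeom γ) +
    smoothConst N γ R B L * (c * (N * gradConst γ R B)) ^ 2

theorem ascentConst_nonneg (N : ℕ) (γ : Set.Ioo (0 : ℝ) 1) {R B c L C : ℝ} (hR : 0 ≤ R) (hB : 0 ≤ B)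
    (hc : 0 ≤ c) (hL : 0 ≤ L) (hC : 0 ≤ C) : 0 ≤ ascentConst N γ R B c L C := by
  have h1 := biasConst_nonneg N hR hB hL
  have h2 := gradJConst_nonneg N γ hR hB
  have h3 := sqGeom_nonneg γ
  have h4 := smoothConst_nonneg N γ (B := B) hR hL
  rw [ascentConst]
  positivity

/-- With learning rates `O(1 / t)` and estimates that are off by `O(1 / t)`, the error of iteration
`t` is `O(1 / t²)`. -/
theorem error_le_ascentConst (N : ℕ) (γ : Set.Ioo (0 : ℝ) 1) {R B c L C η Q s : ℝ} (hR : 0 < R)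
    (hB : 0 < B) (hL : 0 ≤ L) (hC : 0 ≤ C) (hQ : 1 ≤ Q) (hs : 0 ≤ s) (hη : 0 ≤ η)
    (hηs : η ≤ c * s) :
    η * (biasConst N R B L * (N * (C * Q * s)) * gradJConst N γ R B * sqGeom γ) +
      smoothConst N γ R B L * (η * (N * (gradConst γ R B * Q))) ^ 2 ≤
      ascentConst N γ R B c L C * Q ^ 2 * s ^ 2 := by
  have h1 := biasConst_nonneg N hR.le hB.le hL
  have h2 := gradJConst_nonneg N γ hR.le hB.le
  have h3 := sqGeom_nonneg γ
  have h4 := smoothConst_nonneg N γ (B := B) hR.le hL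
  have h5 := gradConst_pos γ hR hB
  have hcs : 0 ≤ c * s := hη.trans hηs
  have hQ0 : 0 ≤ Q := zero_le_one.trans hQ
  have hA : η * (biasConst N R B L * (N * (C * Q * s)) * gradJConst N γ R B * sqGeom γ) ≤
      c * s * (biasConst N R B L * (N * (C * (Q ^ 2) * s)) * gradJConst N γ R B * sqGeom γ) := by
    have : Q ≤ Q ^ 2 := by nlinarith
    gcongr
  have hA' : smoothConst N γ R B L * (η * (N * (gradConst γ R B * Q))) ^ 2 ≤
      smoothConst N γ R B L * (c * s * (N * (gradConst γ R B * Q))) ^ 2 := by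
    gcongr
  refine (add_le_add hA hA').trans (le_of_eq ?_)
  rw [ascentConst]
  ring

/-- The gradient sum over the iterations before the last one, minus the final value of `J`. -/
def potential (M : Model.{u, v, w} G d κp κr) (γ : ℝ) (η : ℕ → ℝ) (n : ℕ)
    (x : Fin (n + 1) → Iterate V d) : ℝ :=
  ∑ k : Fin n, η (k + 1) * ‖gradient (M.J γ) (x k.castSucc).θ‖ ^ 2 - M.J γ (x (Fin.last n)).θ

theorem gradSum_eq (γ : ℝ) (η : ℕ → ℝ) (n : ℕ) (x : Fin (n + 1) → Iterate V d) :
    M.gradSum γ η n x = M.potential γ η n x + (M.J γ (x (Fin.last n)).θ +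
      η (n + 1) * ‖gradient (M.J γ) (x (Fin.last n)).θ‖ ^ 2) := by
  rw [gradSum, Fin.sum_univ_castSucc, potential]
  simp only [Fin.val_castSucc, Fin.val_last]
  ring

theorem potential_snoc (γ : ℝ) (η : ℕ → ℝ) (n : ℕ) (x : Fin (n + 1) → Iterate V d)
    (y : Iterate V d) :
    M.potential γ η (n + 1) (Fin.snoc (α := fun _ => Iterate V d) x y) =
      M.gradSum γ η n x - M.J γ y.θ := by
  simp only [potential, gradSum, Fin.snoc_castSucc, Fin.snoc_last]

theorem abs_gradSum_le (γ : Set.Ioo (0 : ℝ) 1) {R B L : ℝ} (hR : 0 ≤ R) (hB : 0 ≤ B) (hL : 0 ≤ L)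
    (hr : M.RewardBound R) (hs : M.ScoreBound B) (hl : M.ScoreLipschitz L) {η : ℕ → ℝ}
    (hη : ∀ k, 0 ≤ η (k + 1)) (n : ℕ) (x : Fin (n + 1) → Iterate V d) :
    |M.gradSum γ η n x| ≤
      ∑ k : Fin (n + 1), η (k + 1) * gradJConst (Fintype.card V) γ R B ^ 2 := by
  refine (Finset.abs_sum_le_sum_abs _ _).trans (Finset.sum_le_sum fun k _ => ?_)
  rw [abs_mul, abs_of_nonneg (hη k), abs_of_nonneg (sq_nonneg _)]
  exact mul_le_mul_of_nonneg_left
    (pow_le_pow_left₀ (norm_nonneg _) (norm_gradient_J_le γ hR hB hL hr hs hl _) 2) (hη k)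

theorem exists_abs_potential_le (γ : Set.Ioo (0 : ℝ) 1) {R B L : ℝ} (hR : 0 ≤ R) (hB : 0 ≤ B)
    (hL : 0 ≤ L) (hr : M.RewardBound R) (hs : M.ScoreBound B) (hl : M.ScoreLipschitz L) {η : ℕ → ℝ}
    (hη : ∀ k, 0 ≤ η (k + 1)) (n : ℕ) :
    ∃ K, ∀ x : Fin (n + 1) → Iterate V d, |M.potential γ η n x| ≤ K := by
  refine ⟨_, fun x => (abs_sub _ _).trans (add_le_add ((Finset.abs_sum_le_sum_abs _ _).trans
    (Finset.sum_le_sum (g := fun k : Fin n => η (k + 1) * gradJConst (Fintype.card V) γ R B ^ 2)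
    fun k _ => ?_)) (abs_J_le γ hR hr _))⟩
  rw [abs_mul, abs_of_nonneg (hη k), abs_of_nonneg (sq_nonneg _)]
  exact mul_le_mul_of_nonneg_left
    (pow_le_pow_left₀ (norm_nonneg _) (norm_gradient_J_le γ hR hB hL hr hs hl _) 2) (hη k)

theorem expect_potential_le (γ : Set.Ioo (0 : ℝ) 1) {R B c L C : ℝ} (hR : 0 < R) (hB : 0 < B)
    (hL : 0 ≤ L) (hC : 0 ≤ C) (hr : M.RewardBound R) (hs : M.ScoreBound B)
    (hl : M.ScoreLipschitz L) {η : ℕ → ℝ} (hη : ∀ t : ℕ, 1 ≤ t → 0 < η t ∧ η t ≤ c / t) {Q : ℝ}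
    (hQ : Q = maxHop G κp * maxHop G (κp + κr)) (hQ1 : 1 ≤ Q)
    (hcons : ∀ (ω : ℕ → M.Sample) (k : ℕ) (i j : V),
      ‖(M.run γ η ω k).est G i j - (M.run γ η ω k).θ j‖ ≤ C * Q * (1 / ((k : ℝ) + 1))) (n : ℕ) :
    expect (M.runLaw γ η n) (M.potential γ η n) ≤ -M.J γ 0 +
      ∑ k ∈ Finset.range n, ascentConst (Fintype.card V) γ R B c L C * Q ^ 2 *
        (1 / ((k : ℝ) + 1)) ^ 2 := by
  have hη0 : ∀ k, 0 ≤ η (k + 1) := fun k => (hη (k + 1) (Nat.succ_pos k)).1.le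
  induction n with
  | zero =>
    obtain ⟨K, hK⟩ := exists_abs_potential_le γ hR.le hB.le hL hr hs hl hη0 0
    rw [runLaw, chainPath, expect_map _ _ hK, expect_pure]
    simp [potential, Iterate.start]
  | succ n ih =>
    obtain ⟨K, hK⟩ := exists_abs_potential_le γ hR.le hB.le hL hr hs hl hη0 n
    obtain ⟨K', hK'⟩ := exists_abs_potential_le γ hR.le hB.le hL hr hs hl hη0 (n + 1)
    set b := ascentConst (Fintype.card V) γ R B c L C * Q ^ 2 * (1 / ((n : ℝ) + 1)) ^ 2
    have hstep : expect (M.runLaw γ η (n + 1)) (M.potential γ η (n + 1)) ≤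
        expect (M.runLaw γ η n) fun x => M.potential γ η n x + b := by
      rw [runLaw, expect_chainPath_succ _ _ _ hK']
      refine expect_mono _ (fun x => abs_expect_le _ fun y => hK' _)
        (fun x => (abs_add_le _ _).trans (add_le_add (hK x) le_rfl)) fun x hx => ?_
      obtain ⟨ω, hω⟩ := exists_run_of_mem_support γ η n hx
      rw [expect_map (f := fun y => M.potential γ η (n + 1)
        (Fin.snoc (α := fun _ => Iterate V d) x y)) _ _ fun y => hK' _]
      simp_rw [potential_snoc]
      change expect (M.sampleLaw γ ((x (Fin.last n)).est G)) (fun ω' => M.gradSum γ η n x -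
        M.J γ (M.nextθ γ (η (n + 1)) (x (Fin.last n)) ω')) ≤ _
      rw [expect_sub (f := fun _ => M.gradSum γ η n x) _ (fun _ => le_rfl)
        fun ω' => abs_J_le γ hR.le hr _, expect_const, gradSum_eq]
      have hest : ∀ i, ‖(x (Fin.last n)).est G i - (x (Fin.last n)).θ‖ ≤
          Fintype.card V * (C * Q * (1 / ((n : ℝ) + 1))) := by
        intro i
        refine norm_le_card_mul fun j => ?_
        rw [PiLp.sub_apply, hω (Fin.last n)]
        exact hcons ω n i j
      have h1 := le_expect_J_next γ hR.le hB.le hL hr hs hl (hη0 n) (x (Fin.last n))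
        (by positivity) hest
      have h2 := error_le_ascentConst (Fintype.card V) γ (c := c) hR hB hL hC hQ1
        (s := 1 / ((n : ℝ) + 1)) (by positivity) (hη0 n) (by
          have := (hη (n + 1) (Nat.succ_pos n)).2
          push_cast at this
          rwa [mul_one_div])
      rw [← hQ] at h1
      linarith
    rw [expect_add _ hK (fun _ => le_rfl), expect_const] at hstep
    rw [Finset.sum_range_succ]
    linarith

/-- The sum `∑ 1 / t²`. -/
def invSqSum : ℝ := ∑' k : ℕ, (1 / ((k : ℝ) + 1)) ^ 2

theorem sum_inv_sq_le (n : ℕ) : ∑ k ∈ Finset.range n, (1 / ((k : ℝ) + 1)) ^ 2 ≤ invSqSum := by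
  have h : Summable fun k : ℕ => (1 / ((k : ℝ) + 1)) ^ 2 := by
    have h1 := (summable_nat_add_iff 1).2 (Real.summable_one_div_nat_pow.2 one_lt_two)
    refine h1.congr fun k => ?_
    push_cast
    rw [one_div_pow]
  exact h.sum_le_tsum _ fun k _ => sq_nonneg _

theorem invSqSum_nonneg : 0 ≤ invSqSum := tsum_nonneg fun _ => sq_nonneg _

/-- The constant that bounds the expected weighted sum of the squared gradient norms per squared
product of neighbourhood sizes. -/
def totalConst (N : ℕ) (γ R B c L C : ℝ) : ℝ :=
  2 * (R * sqGeom γ) + c * gradJConst N γ R B ^ 2 + ascentConst N γ R B c L C * invSqSum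

theorem totalConst_nonneg (N : ℕ) (γ : Set.Ioo (0 : ℝ) 1) {R B c L C : ℝ} (hR : 0 ≤ R) (hB : 0 ≤ B)
    (hc : 0 ≤ c) (hL : 0 ≤ L) (hC : 0 ≤ C) : 0 ≤ totalConst N γ R B c L C := by
  have h1 := ascentConst_nonneg N γ hR hB hc hL hC
  have h2 := sqGeom_nonneg γ
  have h3 := invSqSum_nonneg
  rw [totalConst]
  positivity

theorem expect_gradSum_le (γ : Set.Ioo (0 : ℝ) 1) {R B c L C : ℝ} (hR : 0 < R) (hB : 0 < B)
    (hc : 0 < c) (hL : 0 ≤ L) (hC : 0 ≤ C) (hr : M.RewardBound R) (hs : M.ScoreBound B)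
    (hl : M.ScoreLipschitz L) {η : ℕ → ℝ} (hη : ∀ t : ℕ, 1 ≤ t → 0 < η t ∧ η t ≤ c / t) {Q : ℝ}
    (hQ : Q = maxHop G κp * maxHop G (κp + κr)) (hQ1 : 1 ≤ Q)
    (hcons : ∀ (ω : ℕ → M.Sample) (k : ℕ) (i j : V),
      ‖(M.run γ η ω k).est G i j - (M.run γ η ω k).θ j‖ ≤ C * Q * (1 / ((k : ℝ) + 1))) (n : ℕ) :
    expect (M.runLaw γ η n) (M.gradSum γ η n) ≤ totalConst (Fintype.card V) γ R B c L C * Q ^ 2 := by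
  have hη0 : ∀ k, 0 ≤ η (k + 1) := fun k => (hη (k + 1) (Nat.succ_pos k)).1.le
  obtain ⟨K, hK⟩ := exists_abs_potential_le γ hR.le hB.le hL hr hs hl hη0 n
  have h1 := expect_potential_le γ hR hB hL hC hr hs hl hη hQ hQ1 hcons n
  have h2 : expect (M.runLaw γ η n) (M.gradSum γ η n) ≤ expect (M.runLaw γ η n) fun x =>
      M.potential γ η n x + (R * sqGeom γ + c * gradJConst (Fintype.card V) γ R B ^ 2) := by
    refine expect_mono _ (abs_gradSum_le γ hR.le hB.le hL hr hs hl hη0 n)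
      (fun x => (abs_add_le _ _).trans (add_le_add (hK x) le_rfl)) fun x _ => ?_
    rw [gradSum_eq]
    have h3 := (abs_le.1 (abs_J_le γ hR.le hr (x (Fin.last n)).θ)).2
    have h4 := pow_le_pow_left₀ (norm_nonneg _)
      (norm_gradient_J_le γ hR.le hB.le hL hr hs hl (x (Fin.last n)).θ) 2
    have h5 : η (n + 1) ≤ c := by
      refine (hη (n + 1) (Nat.succ_pos n)).2.trans (div_le_self hc.le ?_)
      push_cast
      linarith [(Nat.cast_nonneg n : (0 : ℝ) ≤ n)]
    have h6 := mul_le_mul h5 h4 (sq_nonneg _) hc.le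
    linarith
  rw [expect_add _ hK (fun _ => le_rfl), expect_const] at h2
  have h7 := (abs_le.1 (abs_J_le γ hR.le hr (0 : Params V d))).1
  have hA := ascentConst_nonneg (Fintype.card V) γ hR.le hB.le hc.le hL hC
  have h8 := mul_le_mul_of_nonneg_left (sum_inv_sq_le n)
    (mul_nonneg hA (sq_nonneg Q))
  rw [← Finset.mul_sum] at h1
  have hQ2 : 1 ≤ Q ^ 2 := one_le_pow₀ hQ1
  have h9 : 2 * (R * sqGeom γ) + c * gradJConst (Fintype.card V) γ R B ^ 2 ≤
      (2 * (R * sqGeom γ) + c * gradJConst (Fintype.card V) γ R B ^ 2) * Q ^ 2 := by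
    have := sqGeom_nonneg γ
    exact le_mul_of_one_le_right (by positivity) hQ2
  rw [totalConst]
  linarith

theorem avgGrad_nonneg (γ : Set.Ioo (0 : ℝ) 1) {η : ℕ → ℝ} (hη : ∀ k, 0 ≤ η (k + 1)) (n : ℕ) :
    0 ≤ M.avgGrad γ η n :=
  div_nonneg (tsum_nonneg fun _ => mul_nonneg ENNReal.toReal_nonneg
    (Finset.sum_nonneg fun k _ => mul_nonneg (hη k) (sq_nonneg _)))
    (Finset.sum_nonneg fun k _ => hη k)

end Model

end

end DSCP

theorem mainTheorem7 {V : Type w} [Fintype V] (G : SimpleGraph V) (hG : G.Connected)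
    (γ : Set.Ioo (0 : ℝ) 1) (R B c : ℝ) (hR : 0 < R) (hB : 0 < B) (hc : 0 < c) :
    ∃ C : ℝ, 0 < C ∧ ∀ L : ℝ, 0 ≤ L →
    ∃ Jsup : ℕ → ℕ → ℝ, (∀ m m', 0 < Jsup m m') ∧
      (∀ m', StrictMono fun m => Jsup m m') ∧ (∀ m, StrictMono (Jsup m)) ∧
    ∀ (d κp κr : ℕ), 1 ≤ κr → κr ≤ κp →
    ∀ (M : DSCP.Model.{u, v, w} G d κp κr) (η : ℕ → ℝ),
      M.RewardBound R → M.ScoreBound B → M.ScoreLipschitz L →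
      (∀ t : ℕ, 1 ≤ t → 0 < η t ∧ η t ≤ c / t) →
      -- the estimates at iteration `t = k + 1`, for every realization of the samples
      (∀ (ω : ℕ → M.Sample) (k : ℕ) (i j : V),
        ‖(M.run γ η ω k).est G i j - (M.run γ η ω k).θ j‖ ≤
          C * ((DSCP.maxHop G κp * DSCP.maxHop G (κp + κr) * Real.log ((k + 1 : ℕ) : ℝ)) /
            ((k + 1 : ℕ) : ℝ))) ∧
      Differentiable ℝ (M.J γ) ∧
      -- the stationarity guarantee with `T = n + 2`
      (∀ n : ℕ,
        Summable (fun x => (M.runLaw γ η n x).toReal * M.gradSum γ η n x) ∧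
        M.avgGrad γ η n ≤
          Jsup (DSCP.maxHop G κp) (DSCP.maxHop G (κp + κr)) / ∑ k : Fin (n + 1), η (k + 1)) ∧
      (Filter.Tendsto (fun n : ℕ => ∑ k : Fin (n + 1), η (k + 1)) Filter.atTop Filter.atTop →
        Filter.Tendsto (M.avgGrad γ η) Filter.atTop (nhds 0)) := by
  obtain ⟨C, hC, hcons⟩ := DSCP.Model.exists_norm_est_sub_le.{u, v, w} hG γ hR hB hc
  have hlog2 : 0 < Real.log 2 := Real.log_pos one_lt_two
  -- The consensus error vanishes at `t = 1`, and `log t / log 2 ≥ 1` from `t = 2` on.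
  refine ⟨C / Real.log 2, div_pos hC hlog2, fun L hL => ?_⟩
  -- Adding `1` to the constant and to the neighbourhood sizes makes the bound positive and strictly
  -- increasing in both arguments.
  set K := DSCP.Model.totalConst (Fintype.card V) γ R B c L C + 1 with hKdef
  have hK0 := DSCP.Model.totalConst_nonneg (Fintype.card V) γ hR.le hB.le hc.le hL hC.le
  have hK : 0 < K := by linarith
  refine ⟨fun m m' => K * (((m : ℝ) + 1) * ((m' : ℝ) + 1)) ^ 2, fun m m' => by positivity,
    fun m' a b hab => ?_, fun m a b hab => ?_, ?_⟩
  · have : (a : ℝ) < b := by exact_mod_cast hab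
    dsimp only
    gcongr
  · have : (a : ℝ) < b := by exact_mod_cast hab
    dsimp only
    gcongr
  intro d κp κr _ _ M η hr hs hl hη
  have := hG.nonempty
  set Q : ℝ := (DSCP.maxHop G κp : ℝ) * (DSCP.maxHop G (κp + κr) : ℝ) with hQ
  have hm : (1 : ℝ) ≤ DSCP.maxHop G κp := by exact_mod_cast DSCP.one_le_maxHop G κp
  have hm' : (1 : ℝ) ≤ DSCP.maxHop G (κp + κr) := by
    exact_mod_cast DSCP.one_le_maxHop G (κp + κr)
  have hQ1 : 1 ≤ Q := one_le_mul_of_one_le_of_one_le hm hm'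
  have hη0 : ∀ k, 0 ≤ η (k + 1) := fun k => (hη (k + 1) (Nat.succ_pos k)).1.le
  have hcons' := hcons d κp κr M η hr hs hη
  have hbound : ∀ n : ℕ, M.avgGrad γ η n ≤
      K * (((DSCP.maxHop G κp : ℝ) + 1) * ((DSCP.maxHop G (κp + κr) : ℝ) + 1)) ^ 2 /
        ∑ k : Fin (n + 1), η (k + 1) := by
    intro n
    refine div_le_div_of_nonneg_right ?_ (Finset.sum_nonneg fun k _ => hη0 k)
    refine (DSCP.Model.expect_gradSum_le γ hR hB hc hL hC.le hr hs hl hη hQ hQ1 hcons' n).trans ?_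
    rw [hQ]
    gcongr <;> linarith
  refine ⟨fun ω k i j => ?_, fun θ => ?_, fun n => ⟨?_, hbound n⟩, fun hsum => ?_⟩
  · rcases Nat.eq_zero_or_pos k with rfl | hk
    · rw [DSCP.Model.est_run_zero]
      simp
    · refine (hcons' ω k i j).trans ?_
      have h1 : Real.log 2 ≤ Real.log ((k + 1 : ℕ) : ℝ) :=
        Real.log_le_log two_pos (by exact_mod_cast Nat.succ_le_succ hk)
      have h2 : (1 : ℝ) ≤ Real.log ((k + 1 : ℕ) : ℝ) / Real.log 2 := (one_le_div hlog2).2 h1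
      have h3 : C / Real.log 2 * (Q * Real.log ((k + 1 : ℕ) : ℝ) / ((k + 1 : ℕ) : ℝ)) =
          C * Q * (1 / ((k : ℝ) + 1)) * (Real.log ((k + 1 : ℕ) : ℝ) / Real.log 2) := by
        push_cast
        field_simp
      rw [h3]
      exact le_mul_of_one_le_right (by positivity) h2
  · exact (DSCP.Model.hasGradientAt_J γ hR.le hB.le hL hr hs hl θ).1
  · exact DSCP.summable_expect _
      (DSCP.Model.abs_gradSum_le γ hR.le hB.le hL hr hs hl hη0 n)
  · exact squeeze_zero (DSCP.Model.avgGrad_nonneg γ hη0) hbound (hsum.const_div_atTop _)
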